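/- Fix a function $w\in C^\infty(\mathbb R)$ with $w\ge 0$, $\operatorname{supp}w\subset[\tfrac12,2]$ and $w(s)=1-w(s/2)$ for $s\in[1,2]$. For $n\in\mathbb Z$ let $W_n$ be the Schwartz function on $\mathbb R^2$ with $\int W_n(x)e^{-i(x,t)}\,dx=w(\|t\|_2/2^n)$, and for a tempered distribution $f$ on $\mathbb R^2$ put $f_n=f*W_n$ and $$\|f\|_{B^1_{\infty,1}}=\sum_{n\in\mathbb Z}2^n\|f_n\|_{L^\infty(\mathbb R^2)} .$$ The class $B^1_{\infty,1}(\mathbb R^2)$ consists of the tempered distributions $f$ such that $\|f\|_{B^1_{\infty,1}}<\infty$ and $\partial f/\partial x_j=\sum_{n\in\mathbb Z}\partial f_n/\partial x_j$ for $j=1,2$, with convergence in the weak-$*$ topology of $\mathscr S'(\mathbb R^2)$; its elements are identified with continuous complex-valued functions. For finite rank self-adjoint operators $A$, $B$ on a complex Hilbert space with spectral expansions $A=\sum_j\lambda_jP_j$, $B=\sum_k\mu_kQ_k$ (the eigenvalue $0$ included), put $f(A,B)=\sum_{j,k}f(\lambda_j,\mu_k)P_jQ_k$. Let $\|\cdot\|_{S_p}$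 be the Schatten--von Neumann norm, $S_\infty$ being equipped with the operator norm, and let $1/\infty=0$. (a) There is a constant $C$, depending only on $w$, such that for all $p\in[2,\infty]$, all integers $N\ge0$, all self-adjoint operators $A_1,B_1,A_2,B_2$ of rank at most $N$ on a complex Hilbert space (with $0^0=1$), and all $f\in B^1_{\infty,1}(\mathbb R^2)$, $$\|f(A_1,B_1)-f(A_2,B_2)\|_{S_p}\le C\,N^{1/2-1/p}\,\|f\|_{B^1_{\infty,1}}\max\{\|A_1-A_2\|_{S_p},\|B_1-B_2\|_{S_p}\}.$$ (b) The estimate is sharp: there is a constant $c>0$, depending only on $w$, such that for all $p\in[2,\infty]$ and all $N\ge1$ there are a function $f\in B^1_{\infty,1}(\mathbb R^2)$ with $\|f\|_{B^1_{\infty,1}}\le1$ and self-adjoint operators $A_1\ne A_2$ and $B$ on $\mathbb C^N$ (hence of rank at most $N$) with $$\|f(A_1,B)-f(A_2,B)\|_{S_p}\ge c\,N^{1/2-1/p}\,\|A_1-A_2\|_{S_p}.$$ -/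

import Mathlib

open scoped ENNReal NNReal SchwartzMap ContDiff FourierTransform LineDeriv
open MeasureTheory

noncomputable section

/-- Euclidean space `ℝ^d`. -/
abbrev Rn (d : ℕ) : Type := EuclideanSpace ℝ (Fin d)

/-! ### Homogeneous Besov classes -/

/-- The generating functions of the dyadic decomposition: smooth `w ≥ 0` on `ℝ`, supported in
`[1/2, 2]`, with `w s = 1 - w (s / 2)` on `[1, 2]`. -/
structure IsDyadicWindow (w : ℝ → ℝ) : Prop where
  smooth : ContDiff ℝ ∞ w
  nonneg : ∀ s, 0 ≤ w s
  support_subset : Function.support w ⊆ Set.Icc (1 / 2) 2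
  partition : ∀ s ∈ Set.Icc (1 : ℝ) 2, w s = 1 - w (s / 2)

/-- The symbol `t ↦ w (‖t‖ / 2 ^ n)` written in the frequency variable `ξ = t / (2 * π)`, since
Mathlib's Fourier transform has the kernel `exp (-2 * π * i * ⟪x, ξ⟫)` and the kernel meant here is
`exp (-i * ⟪x, t⟫)`. -/
def dyadicSymbol (d : ℕ) (w : ℝ → ℝ) (n : ℤ) (ξ : Rn d) : ℂ :=
  ((w (2 * Real.pi * ‖ξ‖ / 2 ^ n) : ℝ) : ℂ)

theorem dyadicSymbol_contDiff (d : ℕ) {w : ℝ → ℝ} (hw : IsDyadicWindow w) (n : ℤ) :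
    ContDiff ℝ ∞ (dyadicSymbol d w n) := by
  rw [contDiff_iff_contDiffAt]
  intro x
  by_cases hx : x = 0
  · subst hx
    have h0 : ∀ᶠ y in nhds (0 : Rn d), 2 * Real.pi * ‖y‖ / 2 ^ n < 1 / 2 := by
      have hc : Continuous fun y : Rn d => 2 * Real.pi * ‖y‖ / 2 ^ n := by fun_prop
      exact hc.continuousAt.eventually_lt continuousAt_const (by simp)
    refine (contDiffAt_const (c := (0 : ℂ))).congr_of_eventuallyEq ?_
    filter_upwards [h0] with y hy
    have : w (2 * Real.pi * ‖y‖ / 2 ^ n) = 0 := by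
      by_contra h
      exact absurd (hw.support_subset h).1 (not_le.mpr hy)
    simp [dyadicSymbol, this]
  · have h1 : ContDiffAt ℝ ∞ (fun y : Rn d => 2 * Real.pi * ‖y‖ / 2 ^ n) x :=
      (contDiffAt_const.mul (contDiffAt_norm ℝ hx)).div_const _
    exact Complex.ofRealCLM.contDiff.contDiffAt.comp x (hw.smooth.contDiffAt.comp x h1)

theorem dyadicSymbol_hasCompactSupport (d : ℕ) {w : ℝ → ℝ} (hw : IsDyadicWindow w) (n : ℤ) :
    HasCompactSupport (dyadicSymbol d w n) := by
  refine HasCompactSupport.intro (isCompact_closedBall (0 : Rn d) (2 * 2 ^ n)) ?_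
  intro x hx
  have h2 : (0 : ℝ) < 2 ^ n := by positivity
  have hx' : 2 * 2 ^ n < ‖x‖ := by simpa using hx
  have : w (2 * Real.pi * ‖x‖ / 2 ^ n) = 0 := by
    by_contra h
    have := (hw.support_subset h).2
    rw [div_le_iff₀ h2] at this
    nlinarith [Real.pi_gt_three, norm_nonneg x]
  simp [dyadicSymbol, this]

/-- The Schwartz function `W_n` whose Fourier transform is the `n`-th dyadic symbol. -/
def dyadicKernel (d : ℕ) {w : ℝ → ℝ} (hw : IsDyadicWindow w) (n : ℤ) : 𝓢(Rn d, ℂ) :=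
  𝓕⁻ ((dyadicSymbol_hasCompactSupport d hw n).toSchwartzMap (dyadicSymbol_contDiff d hw n))

/-- The convolution `F * φ` of a tempered distribution and a Schwartz function, the function
`x ↦ ⟨F, φ (x - ·)⟩`. -/
def distConv {d : ℕ} (F : 𝓢'(Rn d, ℂ)) (φ : 𝓢(Rn d, ℂ)) (x : Rn d) : ℂ :=
  F ((SchwartzMap.compCLMOfContinuousLinearEquiv ℂ (ContinuousLinearEquiv.neg ℝ) φ).compSubConstCLM
    ℂ x)

/-- The Littlewood--Paley piece `F_n = F * W_n`. -/
def dyadicPiece {d : ℕ} {w : ℝ → ℝ} (hw : IsDyadicWindow w) (F : 𝓢'(Rn d, ℂ)) (n : ℤ) :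
    Rn d → ℂ :=
  distConv F (dyadicKernel d hw n)

/-- `‖F‖_{B^1_{∞,1}} = ∑_{n ∈ ℤ} 2 ^ n ‖F_n‖_{L^∞}`, possibly infinite. -/
def besovNorm {d : ℕ} {w : ℝ → ℝ} (hw : IsDyadicWindow w) (F : 𝓢'(Rn d, ℂ)) : ℝ≥0∞ :=
  ∑' n : ℤ, (2 : ℝ≥0∞) ^ n * eLpNorm (dyadicPiece hw F n) ⊤ volume

/-- The modified homogeneous Besov class `B^1_{∞,1}(ℝ^d)`: the norm is finite and
`∂F/∂x_j = ∑_n ∂F_n/∂x_j` in the weak-* topology of the tempered distributions. -/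
structure MemBesov {d : ℕ} {w : ℝ → ℝ} (hw : IsDyadicWindow w) (F : 𝓢'(Rn d, ℂ)) : Prop where
  norm_ne_top : besovNorm hw F ≠ ⊤
  hasSum_deriv : ∀ (j : Fin d) (φ : 𝓢(Rn d, ℂ)),
    HasSum
      (fun n : ℤ => -∫ x, dyadicPiece hw F n x * (∂_{(EuclideanSpace.single j 1 : Rn d)} φ) x)
      ((∂_{(EuclideanSpace.single j 1 : Rn d)} F) φ)

/-- The tempered distribution `F` is the continuous function `f`. -/
structure IsContinuousFunction {d : ℕ} (F : 𝓢'(Rn d, ℂ)) (f : Rn d → ℂ) : Prop where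
  continuous : Continuous f
  integrable : ∀ φ : 𝓢(Rn d, ℂ), Integrable (fun x => f x * φ x)
  apply_eq : ∀ φ : 𝓢(Rn d, ℂ), F φ = ∫ x, f x * φ x

/-! ### Operators -/

section Operators

variable {H : Type*} [NormedAddCommGroup H] [InnerProductSpace ℂ H]

/-- `T` has rank at most `n`. -/
def RankLE (T : H →L[ℂ] H) (n : ℕ) : Prop :=
  LinearMap.rank (T : H →ₗ[ℂ] H) ≤ (n : Cardinal)

/-- The singular values `s_0 ≥ s_1 ≥ …` of a bounded operator on a Hilbert space: `s_n` is the
distance to the operators of rank at most `n`. -/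
def singularValue (T : H →L[ℂ] H) (n : ℕ) : ℝ≥0∞ :=
  ⨅ (R : H →L[ℂ] H) (_ : RankLE R n), ‖T - R‖ₑ

/-- The Schatten--von Neumann norm `‖T‖_{S_p}`, possibly infinite; `S_∞` has the operator norm. -/
def schattenNorm (p : ℝ≥0∞) (T : H →L[ℂ] H) : ℝ≥0∞ :=
  if p = ⊤ then ‖T‖ₑ else (∑' n : ℕ, singularValue T n ^ p.toReal) ^ (1 / p.toReal)

variable [CompleteSpace H]

/-- The spectral projection `E_A({a})` of a self-adjoint operator with finite spectrum: the
orthogonal projection onto `ker (A - a)`. -/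
def spectralProj (A : H →L[ℂ] H) (a : ℝ) : H →L[ℂ] H :=
  (A - (a : ℂ) • (1 : H →L[ℂ] H)).ker.starProjection

/-- `f(A, B) = ∑ f(a, b) E_A({a}) E_B({b})` for self-adjoint `A`, `B` with finite spectra. The terms
with `a` or `b` not an eigenvalue vanish, so that the sum is finite. -/
def pairFunction (f : Rn 2 → ℂ) (A B : H →L[ℂ] H) : H →L[ℂ] H :=
  ∑ᶠ ab : ℝ × ℝ, f !₂[ab.1, ab.2] • (spectralProj A ab.1 * spectralProj B ab.2)

end Operators

end

/-!
Upper bound. For `p ≥ 2` the `S_p` norm is at most the `S_2` norm, and Hölder's inequality bounds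
the `S_2` norm of `A₁ - A₂`, whose rank is at most `2 * N`, by `(2 * N) ^ (1 / 2 - 1 / p)` times its
`S_p` norm. The estimate thus reduces to the case `p = 2`, and there to the differences
`f_n(A₁, B) - f_n(A₂, B)` for the dyadic pieces `f_n`, which are band limited. In eigenbases of
`A₁`, `A₂` and `B`, a reproducing formula for band limited functions factors the divided difference
`(f_n(x₁, y) - f_n(x₂, y)) / (x₁ - x₂)` as `∫ b(x₁, y, t) a(x₂, t) dt` with uniform `L²` bounds in
`t`, so it acts as a Schur multiplier of norm `≲ 2 ^ n ‖f_n‖_∞`. The second variable is handled by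
taking adjoints, and the pieces are summed over `n`.

Lower bound. Let `A` be diagonal in the standard basis `e i` with eigenvalues `a i`, and `B`
diagonal in the discrete Fourier basis `h k` with eigenvalues `b k`. The coefficients
`θ i k = √N * conj ⟨e i, h k⟩` are unimodular. A sum of translates of `W_0` along a widely spaced
lattice, with coefficients `θ i k`, is a function of Besov norm `O(1)`, whatever `N` is, with
`f(a i + δ, b k) - f(a i, b k) ≈ θ i k * z`. Hence the matrix of `f(A + δ, B) - f(A, B)` in the two
bases has all its entries close to `z / √N`, and testing it against `∑ e i` and `∑ h k` gives an
operator norm of order `√N`, whereas `‖δ‖_{S_p} = N ^ (1 / p) * δ`.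
-/

noncomputable section

/-! ### Schatten norms of operators of finite rank -/

section Schatten

variable {H : Type*} [NormedAddCommGroup H] [InnerProductSpace ℂ H]

theorem RankLE.mono {T : H →L[ℂ] H} {m n : ℕ} (hT : RankLE T m) (hmn : m ≤ n) : RankLE T n :=
  hT.trans (by exact_mod_cast hmn)

theorem rankLE_zero (n : ℕ) : RankLE (0 : H →L[ℂ] H) n := by
  simp [RankLE]

theorem RankLE.eq_zero {T : H →L[ℂ] H} (hT : RankLE T 0) : T = 0 := by
  have h : LinearMap.rank (T : H →ₗ[ℂ] H) = 0 := by simpa [RankLE] using hT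
  rw [LinearMap.rank, Submodule.rank_eq_zero, LinearMap.range_eq_bot] at h
  exact ContinuousLinearMap.coe_injective h

theorem RankLE.neg {T : H →L[ℂ] H} {n : ℕ} (hT : RankLE T n) : RankLE (-T) n := by
  rwa [RankLE, LinearMap.rank, ContinuousLinearMap.toLinearMap_neg, LinearMap.range_neg]

theorem RankLE.add {S T : H →L[ℂ] H} {m n : ℕ} (hS : RankLE S m) (hT : RankLE T n) :
    RankLE (S + T) (m + n) := by
  rw [RankLE, ContinuousLinearMap.toLinearMap_add, Nat.cast_add]
  exact (LinearMap.rank_add_le _ _).trans (add_le_add hS hT)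

theorem RankLE.sub {S T : H →L[ℂ] H} {m n : ℕ} (hS : RankLE S m) (hT : RankLE T n) :
    RankLE (S - T) (m + n) :=
  sub_eq_add_neg S T ▸ hS.add hT.neg

theorem RankLE.finiteDimensional_range {T : H →L[ℂ] H} {n : ℕ} (hT : RankLE T n) :
    FiniteDimensional ℂ (T : H →ₗ[ℂ] H).range :=
  Module.rank_lt_aleph0_iff.1 (hT.trans_lt Cardinal.natCast_lt_aleph0)

theorem singularValue_le_enorm_sub {T R : H →L[ℂ] H} {n : ℕ} (hR : RankLE R n) :
    singularValue T n ≤ ‖T - R‖ₑ :=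
  iInf₂_le R hR

theorem singularValue_le_enorm (T : H →L[ℂ] H) (n : ℕ) : singularValue T n ≤ ‖T‖ₑ := by
  simpa using singularValue_le_enorm_sub (T := T) (rankLE_zero n)

theorem singularValue_zero_right (T : H →L[ℂ] H) : singularValue T 0 = ‖T‖ₑ := by
  refine le_antisymm (singularValue_le_enorm T 0) (le_iInf₂ fun R hR => ?_)
  simp [hR.eq_zero]

theorem singularValue_eq_zero {T : H →L[ℂ] H} {m n : ℕ} (hT : RankLE T m) (hmn : m ≤ n) :
    singularValue T n = 0 := by
  have h := singularValue_le_enorm_sub (T := T) (hT.mono hmn)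
  rwa [sub_self, ← ofReal_norm, norm_zero, ENNReal.ofReal_zero, nonpos_iff_eq_zero] at h

theorem schattenNorm_top (T : H →L[ℂ] H) : schattenNorm ⊤ T = ‖T‖ₑ :=
  if_pos rfl

theorem schattenNorm_eq_eLpNorm {p : ℝ≥0∞} (hp : p ≠ 0) (T : H →L[ℂ] H) :
    schattenNorm p T = eLpNorm (singularValue T) p Measure.count := by
  by_cases h : p = ⊤
  · subst h
    rw [schattenNorm_top, eLpNorm_exponent_top, eLpNormEssSup_count]
    refine le_antisymm ?_ (iSup_le fun n => singularValue_le_enorm T n)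
    exact (singularValue_zero_right T).ge.trans (le_iSup (fun n => ‖singularValue T n‖ₑ) 0)
  · rw [schattenNorm, if_neg h, eLpNorm_eq_lintegral_rpow_enorm_toReal hp h, lintegral_count]
    simp

theorem eLpNorm_count_anti {α : Type*} [MeasurableSpace α] [MeasurableSingletonClass α]
    {p q : ℝ≥0∞} (hp : p ≠ 0) (hpq : p ≤ q) (f : α → ℝ≥0∞) :
    eLpNorm f q Measure.count ≤ eLpNorm f p Measure.count := by
  have hle (i : α) : f i ≤ eLpNorm f p Measure.count := enorm_le_eLpNorm_count f i hp
  obtain rfl | hq := eq_or_ne q ⊤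
  · rw [eLpNorm_exponent_top, eLpNormEssSup_count]
    exact iSup_le hle
  have hp' : p ≠ ⊤ := (hpq.trans_lt hq.lt_top).ne
  have hp0 : 0 < p.toReal := ENNReal.toReal_pos hp hp'
  have hpq' : p.toReal ≤ q.toReal := ENNReal.toReal_mono hq hpq
  have hq0 : 0 < q.toReal := hp0.trans_le hpq'
  set S := eLpNorm f p Measure.count with hS
  have hSp : ∑' i, f i ^ p.toReal = S ^ p.toReal := by
    rw [hS, eLpNorm_eq_lintegral_rpow_enorm_toReal hp hp', lintegral_count, ← ENNReal.rpow_mul,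
      one_div_mul_cancel hp0.ne', ENNReal.rpow_one]
    simp
  rw [eLpNorm_eq_lintegral_rpow_enorm_toReal (hp.bot_lt.trans_le hpq).ne' hq, lintegral_count,
    one_div, ENNReal.rpow_inv_le_iff hq0]
  have hadd (x : ℝ≥0∞) : x ^ p.toReal * x ^ (q.toReal - p.toReal) = x ^ q.toReal := by
    rw [← ENNReal.rpow_add_of_nonneg _ _ hp0.le (sub_nonneg.2 hpq'), add_sub_cancel]
  calc ∑' i, ‖f i‖ₑ ^ q.toReal = ∑' i, f i ^ p.toReal * f i ^ (q.toReal - p.toReal) := by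
        simp only [hadd, enorm_eq_self]
    _ ≤ ∑' i, f i ^ p.toReal * S ^ (q.toReal - p.toReal) := by
        gcongr with i
        exact hle i
    _ = S ^ q.toReal := by rw [ENNReal.tsum_mul_right, hSp, hadd]

theorem schattenNorm_anti {p q : ℝ≥0∞} (hp : p ≠ 0) (hpq : p ≤ q) (T : H →L[ℂ] H) :
    schattenNorm q T ≤ schattenNorm p T := by
  rw [schattenNorm_eq_eLpNorm hp, schattenNorm_eq_eLpNorm (hp.bot_lt.trans_le hpq).ne']
  exact eLpNorm_count_anti hp hpq _

theorem schattenNorm_le_rank_rpow_mul {p q : ℝ≥0∞} (hp : p ≠ 0) (hpq : p ≤ q) {T : H →L[ℂ] H}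
    {n : ℕ} (hT : RankLE T n) :
    schattenNorm p T ≤ (n : ℝ≥0∞) ^ (1 / p.toReal - 1 / q.toReal) * schattenNorm q T := by
  have hsupp : (singularValue T).support ⊆ Finset.range n := fun k hk => by
    by_contra hkn
    exact hk (singularValue_eq_zero hT (by simpa using hkn))
  rw [schattenNorm_eq_eLpNorm hp, schattenNorm_eq_eLpNorm (hp.bot_lt.trans_le hpq).ne',
    ← eLpNorm_restrict_eq_of_support_subset hsupp (p := p),
    ← eLpNorm_restrict_eq_of_support_subset hsupp (p := q), mul_comm]
  refine (eLpNorm_le_eLpNorm_mul_rpow_measure_univ hpq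
    (measurable_from_nat.aestronglyMeasurable)).trans_eq ?_
  rw [Measure.restrict_apply_univ, Measure.count_apply_finset, Finset.card_range]

variable [CompleteSpace H]

theorem RankLE.adjoint {T : H →L[ℂ] H} {n : ℕ} (hT : RankLE T n) : RankLE T.adjoint n := by
  have := hT.finiteDimensional_range
  set K := (T : H →ₗ[ℂ] H).range
  have hTK : K.starProjection ∘L T = T := by
    ext x
    exact Submodule.starProjection_eq_self_iff.2 (LinearMap.mem_range_self _ x)
  have hadj : T.adjoint ∘L K.starProjection = T.adjoint := by
    nth_rw 2 [← hTK]
    rw [ContinuousLinearMap.adjoint_comp, (isSelfAdjoint_starProjection K).adjoint_eq]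
  have hle : (T.adjoint : H →ₗ[ℂ] H).range ≤ K.map (T.adjoint : H →ₗ[ℂ] H) := by
    rintro _ ⟨x, rfl⟩
    exact ⟨K.starProjection x, K.starProjection_apply_mem x, congr($hadj x)⟩
  exact (Submodule.rank_mono hle).trans ((rank_map_le _ _).trans hT)

theorem singularValue_adjoint (T : H →L[ℂ] H) (n : ℕ) :
    singularValue T.adjoint n = singularValue T n := by
  have hle (S : H →L[ℂ] H) : singularValue S.adjoint n ≤ singularValue S n := by
    refine le_iInf₂ fun R hR => (singularValue_le_enorm_sub hR.adjoint).trans_eq ?_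
    rw [← map_sub, LinearIsometryEquiv.enorm_map]
  exact (hle T).antisymm (by simpa using hle T.adjoint)

theorem schattenNorm_adjoint (p : ℝ≥0∞) (T : H →L[ℂ] H) :
    schattenNorm p T.adjoint = schattenNorm p T := by
  simp only [schattenNorm, singularValue_adjoint, LinearIsometryEquiv.enorm_map]

end Schatten

section SingularSystem

variable {H : Type*} [NormedAddCommGroup H] [InnerProductSpace ℂ H]

theorem norm_sum_smul_sq_of_pairwise_inner_eq_zero {ι : Type*} (s : Finset ι) {y : ι → H}
    (hy : Pairwise fun i j => inner ℂ (y i) (y j) = 0) (c : ι → ℂ) :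
    ‖∑ i ∈ s, c i • y i‖ ^ 2 = ∑ i ∈ s, ‖c i‖ ^ 2 * ‖y i‖ ^ 2 := by
  have h : ((‖∑ i ∈ s, c i • y i‖ ^ 2 : ℝ) : ℂ) =
      ((∑ i ∈ s, ‖c i‖ ^ 2 * ‖y i‖ ^ 2 : ℝ) : ℂ) := by
    have hself (x : H) : ((‖x‖ ^ 2 : ℝ) : ℂ) = inner ℂ x x := by
      simp
    simp only [hself, sum_inner, inner_sum, inner_smul_left, inner_smul_right, Complex.ofReal_sum,
      Complex.ofReal_mul (_ ^ 2)]
    refine Finset.sum_congr rfl fun i hi => ?_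
    rw [Finset.sum_eq_single_of_mem i hi fun j _ hj => by rw [hy hj, mul_zero],
      Complex.ofReal_pow, ← Complex.conj_mul', mul_assoc, mul_left_comm]
  exact_mod_cast h

/-- A singular system of `T`: orthonormal vectors `v i` through which `T` factors and which it maps
to pairwise orthogonal vectors of nonincreasing lengths, so that the singular values of `T` are
`‖T (v i)‖`. -/
structure IsSingularSystem (T : H →L[ℂ] H) {m : ℕ} (v : Fin m → H) : Prop where
  orthonormal : Orthonormal ℂ v
  apply_eq_sum : ∀ x, T x = ∑ i, inner ℂ (v i) x • T (v i)
  inner_apply_eq_zero : Pairwise fun i j => inner ℂ (T (v i)) (T (v j)) = 0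
  antitone : Antitone fun i => ‖T (v i)‖

theorem rankLE_sum_rankOne {ι : Type*} (s : Finset ι) (v y : ι → H) :
    RankLE (∑ i ∈ s, (innerSL ℂ (v i)).smulRight (y i)) s.card := by
  classical
  have hle : LinearMap.range ((∑ i ∈ s, (innerSL ℂ (v i)).smulRight (y i) : H →L[ℂ] H) : H →ₗ[ℂ] H)
      ≤ Submodule.span ℂ (s.image y : Finset H) := by
    rintro _ ⟨x, rfl⟩
    simp only [ContinuousLinearMap.coe_coe, sum_apply, ContinuousLinearMap.smulRight_apply]
    exact Submodule.sum_mem _ fun i hi => Submodule.smul_mem _ _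
      (Submodule.subset_span (Finset.mem_image_of_mem y hi))
  refine (Submodule.rank_mono hle).trans ((rank_span_finset_le _).trans ?_)
  exact_mod_cast Finset.card_image_le

theorem RankLE.exists_ne_zero_apply_sum_eq_zero {R : H →L[ℂ] H} {n : ℕ} (hR : RankLE R n)
    {ι : Type*} [Fintype ι] (hι : n < Fintype.card ι) (v : ι → H) :
    ∃ c : ι → ℂ, c ≠ 0 ∧ R (∑ i, c i • v i) = 0 := by
  have := hR.finiteDimensional_range
  let f : (ι → ℂ) →ₗ[ℂ] (R : H →ₗ[ℂ] H).range :=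
    (R : H →ₗ[ℂ] H).rangeRestrict ∘ₗ Fintype.linearCombination ℂ v
  have hdim : Module.finrank ℂ (R : H →ₗ[ℂ] H).range < Module.finrank ℂ (ι → ℂ) := by
    rw [Module.finrank_fintype_fun_eq_card]
    exact (Module.finrank_le_of_rank_le hR).trans_lt hι
  obtain ⟨c, hc, hc0⟩ := (Submodule.ne_bot_iff _).1
    (LinearMap.ker_ne_bot_of_finrank_lt (f := f) hdim)
  refine ⟨c, hc0, ?_⟩
  simpa [f, Fintype.linearCombination_apply] using congrArg Subtype.val (LinearMap.mem_ker.1 hc)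

namespace IsSingularSystem

variable {T : H →L[ℂ] H} {m : ℕ} {v : Fin m → H}

theorem eq_sum (h : IsSingularSystem T v) : T = ∑ i, (innerSL ℂ (v i)).smulRight (T (v i)) := by
  ext x
  rw [h.apply_eq_sum x]
  simp

theorem rankLE (h : IsSingularSystem T v) : RankLE T m := by
  simpa [← h.eq_sum] using rankLE_sum_rankOne Finset.univ v fun i => T (v i)

theorem singularValue_le (h : IsSingularSystem T v) (n : Fin m) :
    singularValue T n ≤ ‖T (v n)‖ₑ := by
  let R : H →L[ℂ] H := ∑ i ∈ Finset.Iio n, (innerSL ℂ (v i)).smulRight (T (v i))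
  have hR : RankLE R n := by
    simpa using rankLE_sum_rankOne (Finset.Iio n) v fun i => T (v i)
  refine (singularValue_le_enorm_sub hR).trans ?_
  rw [← ofReal_norm, ← ofReal_norm]
  refine ENNReal.ofReal_le_ofReal <|
    ContinuousLinearMap.opNorm_le_bound _ (norm_nonneg _) fun x => ?_
  have hx : (T - R) x = ∑ i ∈ (Finset.Iio n)ᶜ, inner ℂ (v i) x • T (v i) := by
    rw [sub_apply, h.apply_eq_sum x, ← Finset.sum_add_sum_compl (Finset.Iio n)]
    simp [R]
  rw [hx, ← sq_le_sq₀ (norm_nonneg _) (by positivity),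
    norm_sum_smul_sq_of_pairwise_inner_eq_zero _ h.inner_apply_eq_zero, mul_pow]
  calc ∑ i ∈ (Finset.Iio n)ᶜ, ‖inner ℂ (v i) x‖ ^ 2 * ‖T (v i)‖ ^ 2
      ≤ ∑ i ∈ (Finset.Iio n)ᶜ, ‖inner ℂ (v i) x‖ ^ 2 * ‖T (v n)‖ ^ 2 := by
        gcongr with i hi
        exact h.antitone (by simpa using hi)
    _ = ‖T (v n)‖ ^ 2 * ∑ i ∈ (Finset.Iio n)ᶜ, ‖inner ℂ (v i) x‖ ^ 2 := by
        rw [← Finset.sum_mul, mul_comm]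
    _ ≤ ‖T (v n)‖ ^ 2 * ‖x‖ ^ 2 := by
        gcongr
        exact h.orthonormal.sum_inner_products_le x

theorem norm_apply_mul_norm_sum_le (h : IsSingularSystem T v) (n : Fin m) {ι : Type*} [Fintype ι]
    {j : ι → Fin m} (hj : j.Injective) (hjn : ∀ i, j i ≤ n) (c : ι → ℂ) :
    ‖T (v n)‖ * ‖∑ i, c i • v (j i)‖ ≤ ‖T (∑ i, c i • v (j i))‖ := by
  have hu : ‖∑ i, c i • v (j i)‖ ^ 2 = ∑ i, ‖c i‖ ^ 2 := by
    rw [norm_sum_smul_sq_of_pairwise_inner_eq_zero _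
      fun i k hik => h.orthonormal.2 (hj.ne hik)]
    simp [h.orthonormal.1]
  rw [← sq_le_sq₀ (by positivity) (norm_nonneg _), mul_pow, hu, map_sum]
  simp only [map_smul]
  rw [norm_sum_smul_sq_of_pairwise_inner_eq_zero _
    fun i k hik => h.inner_apply_eq_zero (hj.ne hik), Finset.mul_sum]
  simp only [mul_comm (‖T (v n)‖ ^ 2)]
  gcongr with i
  exact h.antitone (hjn i)

theorem le_singularValue (h : IsSingularSystem T v) (n : Fin m) :
    ‖T (v n)‖ₑ ≤ singularValue T n := by
  refine le_iInf₂ fun R hR => ?_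
  let j : Fin (n + 1) → Fin m := Fin.castLE n.2
  have hj : j.Injective := Fin.castLE_injective _
  obtain ⟨c, hc, hcR⟩ := hR.exists_ne_zero_apply_sum_eq_zero (ι := Fin (n + 1)) (by simp) (v ∘ j)
  set u := ∑ i, c i • v (j i)
  have hu₀ : 0 < ‖u‖ := norm_pos_iff.2 fun h0 => hc <| funext <|
    Fintype.linearIndependent_iff.1 (h.orthonormal.linearIndependent.comp j hj) c h0
  have hle : ‖T (v n)‖ * ‖u‖ ≤ ‖T - R‖ * ‖u‖ := by
    have hjn (i) : j i ≤ n := Fin.le_def.2 (Nat.lt_succ_iff.1 i.2)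
    refine (h.norm_apply_mul_norm_sum_le n hj hjn c).trans ?_
    have := (T - R).le_opNorm u
    rwa [sub_apply, show R u = 0 from hcR, sub_zero] at this
  rw [← ofReal_norm, ← ofReal_norm]
  exact ENNReal.ofReal_le_ofReal (le_of_mul_le_mul_right hle hu₀)

theorem singularValue_eq (h : IsSingularSystem T v) (n : Fin m) :
    singularValue T n = ‖T (v n)‖ₑ :=
  (h.singularValue_le n).antisymm (h.le_singularValue n)

theorem schattenNorm_two (h : IsSingularSystem T v) :
    schattenNorm 2 T = ENNReal.ofReal √(∑ i, ‖T (v i)‖ ^ 2) := by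
  rw [schattenNorm, if_neg (by simp), tsum_eq_sum (s := Finset.range m) fun k hk => by
      rw [singularValue_eq_zero h.rankLE (by simpa using hk), ENNReal.zero_rpow_of_pos (by simp)],
    Finset.sum_range, Real.sqrt_eq_rpow, ← ENNReal.ofReal_rpow_of_nonneg (by positivity) (by simp),
    ENNReal.ofReal_sum_of_nonneg fun _ _ => by positivity]
  simp only [h.singularValue_eq, ENNReal.toReal_ofNat, ENNReal.rpow_two, ← ofReal_norm,
    ENNReal.ofReal_pow (norm_nonneg _)]

end IsSingularSystem

variable {K : Submodule ℂ H} [FiniteDimensional ℂ K]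

theorem apply_eq_sum_inner_smul {T : H →L[ℂ] H} (hT : ∀ x ∈ Kᗮ, T x = 0) {ι : Type*}
    [Fintype ι] (b : OrthonormalBasis ι ℂ K) (x : H) :
    T x = ∑ i, inner ℂ (b i : H) x • T (b i) := by
  have hTx : T x = T (K.starProjection x) := by
    rw [← sub_eq_zero, ← map_sub]
    exact hT _ (K.sub_starProjection_mem_orthogonal x)
  rw [hTx, Submodule.starProjection_apply]
  conv_lhs => rw [← b.sum_repr (K.orthogonalProjectionOnto x)]
  simp only [Submodule.coe_sum, Submodule.coe_smul, map_sum, map_smul, b.repr_apply_apply]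
  refine Finset.sum_congr rfl fun i _ => ?_
  congr 1
  rw [Submodule.coe_inner, ← Submodule.starProjection_apply,
    ← Submodule.inner_starProjection_left_eq_right,
    Submodule.starProjection_eq_self_iff.2 (b i).2]

variable [CompleteSpace H]

theorem exists_isSingularSystem {T : H →L[ℂ] H} (hT : ∀ x ∈ Kᗮ, T x = 0) :
    ∃ v : OrthonormalBasis (Fin (Module.finrank ℂ K)) ℂ K,
      IsSingularSystem T fun i => (v i : H) := by
  let S : K →L[ℂ] H := T ∘L K.subtypeL
  let Q : K →L[ℂ] K := S.adjoint ∘L S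
  have hQ : (Q : K →ₗ[ℂ] K).IsSymmetric := fun x y => by
    simp only [Q, ContinuousLinearMap.coe_coe, ContinuousLinearMap.comp_apply]
    rw [ContinuousLinearMap.adjoint_inner_left, ContinuousLinearMap.adjoint_inner_right]
  let v := hQ.eigenvectorBasis rfl
  have hv (i j) : inner ℂ (T (v i)) (T (v j)) =
      if i = j then (hQ.eigenvalues rfl i : ℂ) else 0 := by
    have hQv : Q (v j) = (hQ.eigenvalues rfl j : ℂ) • v j := hQ.apply_eigenvectorBasis rfl j
    calc inner ℂ (T (v i)) (T (v j)) = inner ℂ (v i) (Q (v j)) := by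
          simp only [Q, ContinuousLinearMap.comp_apply, ContinuousLinearMap.adjoint_inner_right]
          rfl
      _ = _ := by
          rw [hQv, inner_smul_right, orthonormal_iff_ite.1 v.orthonormal i j]
          split_ifs with h
          · rw [h, mul_one]
          · rw [mul_zero]
  have hnorm (i) : ‖T (v i)‖ ^ 2 = hQ.eigenvalues rfl i := by
    have := inner_self_eq_norm_sq_to_K (𝕜 := ℂ) (T (v i))
    rw [hv, if_pos rfl] at this
    exact Complex.ofReal_injective (by simpa using this.symm)
  refine ⟨v, v.orthonormal.comp_linearIsometry K.subtypeₗᵢ, apply_eq_sum_inner_smul hT v,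
    fun i j hij => (hv i j).trans (if_neg hij), fun i j hij => ?_⟩
  rw [← sq_le_sq₀ (norm_nonneg _) (norm_nonneg _), hnorm, hnorm]
  exact hQ.eigenvalues_antitone rfl hij

theorem sum_norm_sq_apply_eq_trace (T : H →L[ℂ] H) {ι : Type*} [Fintype ι]
    (b : OrthonormalBasis ι ℂ K) :
    ((∑ i, ‖T (b i)‖ ^ 2 : ℝ) : ℂ) = LinearMap.trace ℂ K
      (((T ∘L K.subtypeL).adjoint ∘L (T ∘L K.subtypeL) : K →L[ℂ] K) : K →ₗ[ℂ] K) := by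
  rw [LinearMap.trace_eq_sum_inner _ b, Complex.ofReal_sum]
  refine Finset.sum_congr rfl fun i _ => ?_
  rw [Complex.ofReal_pow, ContinuousLinearMap.coe_coe, ContinuousLinearMap.comp_apply,
    ContinuousLinearMap.adjoint_inner_right, inner_self_eq_norm_sq_to_K]
  rfl

theorem schattenNorm_two_eq {T : H →L[ℂ] H} (hT : ∀ x ∈ Kᗮ, T x = 0) {ι : Type*} [Fintype ι]
    (b : OrthonormalBasis ι ℂ K) :
    schattenNorm 2 T = ENNReal.ofReal √(∑ i, ‖T (b i)‖ ^ 2) := by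
  obtain ⟨v, hv⟩ := exists_isSingularSystem hT
  have hsum : ∑ i, ‖T (v i)‖ ^ 2 = ∑ i, ‖T (b i)‖ ^ 2 := by
    exact_mod_cast (sum_norm_sq_apply_eq_trace T v).trans (sum_norm_sq_apply_eq_trace T b).symm
  rw [hv.schattenNorm_two, hsum]

end SingularSystem

/-! ### Functions of pairs of self-adjoint operators of finite rank -/

section OrthonormalBasisOfSubmodule

variable {H : Type*} [NormedAddCommGroup H] [InnerProductSpace ℂ H] {K : Submodule ℂ H}
  {ι : Type*} [Fintype ι]

theorem sum_inner_mul_inner_coe (g : OrthonormalBasis ι ℂ K) {x : H} (hx : x ∈ K) (y : H) :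
    ∑ i, inner ℂ x (g i : H) * inner ℂ (g i : H) y = inner ℂ x y := by
  have h := congrArg (fun z : K => inner ℂ (z : H) y) (g.sum_repr ⟨x, hx⟩)
  simpa only [Submodule.coe_sum, Submodule.coe_smul, sum_inner, inner_smul_left,
    g.repr_apply_apply, Submodule.coe_inner, inner_conj_symm] using h

theorem sum_norm_inner_sq_coe (g : OrthonormalBasis ι ℂ K) {x : H} (hx : x ∈ K) :
    ∑ i, ‖inner ℂ (g i : H) x‖ ^ 2 = ‖x‖ ^ 2 := by
  simpa [Submodule.coe_inner] using g.sum_sq_norm_inner_right ⟨x, hx⟩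

theorem sum_norm_sq_sum_mul_inner_coe {κ : Type*} [Fintype κ] (g : OrthonormalBasis ι ℂ K)
    (h : OrthonormalBasis κ ℂ K) (c : ι → ℂ) :
    ∑ k, ‖∑ m, c m * inner ℂ (g m : H) (h k : H)‖ ^ 2 = ∑ m, ‖c m‖ ^ 2 := by
  let x : H := ∑ m, star (c m) • (g m : H)
  have hxK : x ∈ K := K.sum_mem fun m _ => K.smul_mem _ (g m).2
  have hx : ‖x‖ ^ 2 = ∑ m, ‖c m‖ ^ 2 :=
    (norm_sum_smul_sq_of_pairwise_inner_eq_zero _ (y := fun m => (g m : H))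
      (fun i j hij => g.orthonormal.2 hij) _).trans (by simp [← Submodule.coe_norm])
  rw [← hx, ← sum_norm_inner_sq_coe h hxK]
  refine Finset.sum_congr rfl fun k _ => ?_
  rw [norm_inner_symm]
  simp [x, sum_inner, inner_smul_left]

end OrthonormalBasisOfSubmodule

section HilbertSchmidt

variable {H : Type*} [NormedAddCommGroup H] [InnerProductSpace ℂ H] [CompleteSpace H]
  {K : Submodule ℂ H} [FiniteDimensional ℂ K]

theorem schattenNorm_two_eq_sum_inner {T : H →L[ℂ] H} (hT : ∀ x ∈ Kᗮ, T x = 0)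
    (hTK : ∀ x ∈ K, T x ∈ K) {ι κ : Type*} [Fintype ι] [Fintype κ] (e : OrthonormalBasis ι ℂ K)
    (h : OrthonormalBasis κ ℂ K) :
    schattenNorm 2 T = ENNReal.ofReal √(∑ i, ∑ k, ‖inner ℂ (e i : H) (T (h k))‖ ^ 2) := by
  rw [schattenNorm_two_eq hT h, Finset.sum_comm]
  simp only [sum_norm_inner_sq_coe e (hTK _ (h _).2)]

theorem schattenNorm_two_add_le {S T : H →L[ℂ] H} (hS : ∀ x ∈ Kᗮ, S x = 0)
    (hT : ∀ x ∈ Kᗮ, T x = 0) : schattenNorm 2 (S + T) ≤ schattenNorm 2 S + schattenNorm 2 T := by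
  let b := stdOrthonormalBasis ℂ K
  let v : (H →L[ℂ] H) → PiLp 2 fun _ : Fin (Module.finrank ℂ K) => H := fun T =>
    WithLp.toLp 2 fun i => T (b i)
  have hv {R : H →L[ℂ] H} (hR : ∀ x ∈ Kᗮ, R x = 0) : schattenNorm 2 R = ‖v R‖ₑ := by
    rw [schattenNorm_two_eq hR b, ← ofReal_norm, PiLp.norm_eq_of_L2]
  have hST : ∀ x ∈ Kᗮ, (S + T) x = 0 := fun x hx => by simp [hS x hx, hT x hx]
  rw [hv hS, hv hT, hv hST]
  exact enorm_add_le (v S) (v T)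

end HilbertSchmidt

section PairFunction

variable {H : Type*} [NormedAddCommGroup H] [InnerProductSpace ℂ H]

theorem mem_ker_sub_smul_one {A : H →L[ℂ] H} {a : ℝ} {u : H} :
    u ∈ (A - (a : ℂ) • (1 : H →L[ℂ] H)).ker ↔ A u = (a : ℂ) • u := by
  simp [sub_eq_zero]

theorem exists_finiteDimensional_forall_apply_mem {ι : Type*} [Finite ι] {A : ι → H →L[ℂ] H} {n : ℕ}
    (hA : ∀ i, RankLE (A i) n) :
    ∃ K : Submodule ℂ H, FiniteDimensional ℂ K ∧ ∀ i x, A i x ∈ K := by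
  have := fun i => (hA i).finiteDimensional_range
  exact ⟨⨆ i, (A i : H →ₗ[ℂ] H).range, inferInstance, fun i x =>
    Submodule.mem_iSup_of_mem i (LinearMap.mem_range_self _ x)⟩

variable [CompleteSpace H]

/-- `A` is a self-adjoint operator with range in the subspace `K`; then `A` vanishes on `Kᗮ`. For
finite dimensional `K` this is how finite rank self-adjoint operators are handled, with one `K` for
all operators involved. -/
structure IsSelfAdjointIn (K : Submodule ℂ H) (A : H →L[ℂ] H) : Prop where
  isSelfAdjoint : IsSelfAdjoint A
  apply_mem : ∀ x, A x ∈ K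

theorem inner_apply_of_eigen {A : H →L[ℂ] H} (hA : IsSelfAdjoint A) {a : ℝ} {u : H}
    (hu : A u = (a : ℂ) • u) (v : H) : inner ℂ u (A v) = a * inner ℂ u v := by
  rw [← ContinuousLinearMap.adjoint_inner_left, hA.adjoint_eq, hu, inner_smul_left,
    Complex.conj_ofReal]

theorem spectralProj_apply_of_eigen {A : H →L[ℂ] H} {a : ℝ} {u : H} (hu : A u = (a : ℂ) • u) :
    spectralProj A a u = u :=
  Submodule.starProjection_eq_self_iff.2 (mem_ker_sub_smul_one.2 hu)

theorem spectralProj_apply_of_eigen_of_ne {A : H →L[ℂ] H} (hA : IsSelfAdjoint A) {a b : ℝ} {u : H}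
    (hu : A u = (a : ℂ) • u) (hab : b ≠ a) : spectralProj A b u = 0 := by
  refine (Submodule.starProjection_apply_eq_zero_iff _).2 ((Submodule.mem_orthogonal _ _).2 ?_)
  intro v hv
  have h := inner_apply_of_eigen hA (mem_ker_sub_smul_one.1 hv) u
  rw [hu, inner_smul_right, ← sub_eq_zero, ← sub_mul] at h
  exact (mul_eq_zero.1 h).resolve_left (sub_ne_zero.2 (by exact_mod_cast hab.symm))

theorem adjoint_spectralProj (A : H →L[ℂ] H) (a : ℝ) :
    (spectralProj A a).adjoint = spectralProj A a :=
  (isSelfAdjoint_starProjection _).adjoint_eq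

theorem adjoint_pairFunction (f : Rn 2 → ℂ) (A B : H →L[ℂ] H) :
    (pairFunction f A B).adjoint = pairFunction (fun x => star (f !₂[x 1, x 0])) B A := by
  rw [pairFunction, pairFunction, ← finsum_comp_equiv (Equiv.prodComm ℝ ℝ)]
  refine (ContinuousLinearMap.adjoint (𝕜 := ℂ) (E := H) (F := H)).toAddEquiv.map_finsum _ |>.trans
    (finsum_congr fun ab => ?_)
  change (f !₂[ab.2, ab.1] • (spectralProj A ab.2 ∘L spectralProj B ab.1)).adjoint = _
  rw [map_smulₛₗ, ContinuousLinearMap.adjoint_comp, adjoint_spectralProj, adjoint_spectralProj]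
  rfl

namespace IsSelfAdjointIn

variable {K : Submodule ℂ H} {A B : H →L[ℂ] H}

theorem apply_eq_zero (hA : IsSelfAdjointIn K A) {x : H} (hx : x ∈ Kᗮ) : A x = 0 := by
  rw [← inner_self_eq_zero (𝕜 := ℂ), ← ContinuousLinearMap.adjoint_inner_right,
    hA.isSelfAdjoint.adjoint_eq]
  exact Submodule.inner_left_of_mem_orthogonal (hA.apply_mem _) hx

theorem apply_eq_zero_smul (hA : IsSelfAdjointIn K A) {x : H} (hx : x ∈ Kᗮ) :
    A x = ((0 : ℝ) : ℂ) • x := by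
  rw [hA.apply_eq_zero hx, Complex.ofReal_zero, zero_smul]

theorem sub_apply_eq_zero (hA : IsSelfAdjointIn K A) (hB : IsSelfAdjointIn K B) :
    ∀ x ∈ Kᗮ, (A - B) x = 0 := fun x hx => by
  rw [sub_apply, hA.apply_eq_zero hx, hB.apply_eq_zero hx, sub_self]

variable [FiniteDimensional ℂ K]

theorem exists_eigenbasis (hA : IsSelfAdjointIn K A) :
    ∃ (e : OrthonormalBasis (Fin (Module.finrank ℂ K)) ℂ K) (a : Fin (Module.finrank ℂ K) → ℝ),
      ∀ i, A (e i) = (a i : ℂ) • (e i : H) := by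
  let A' : K →ₗ[ℂ] K := (A : H →ₗ[ℂ] H).restrict fun x _ => hA.apply_mem x
  have hA' : A'.IsSymmetric := fun x y => by
    change inner ℂ (A x) (y : H) = inner ℂ (x : H) (A y)
    rw [← ContinuousLinearMap.adjoint_inner_right, hA.isSelfAdjoint.adjoint_eq]
  exact ⟨hA'.eigenvectorBasis rfl, hA'.eigenvalues rfl, fun i =>
    congrArg Subtype.val (hA'.apply_eigenvectorBasis rfl i)⟩

theorem finite_spectralProj_ne_zero (hA : IsSelfAdjointIn K A) :
    {a : ℝ | spectralProj A a ≠ 0}.Finite := by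
  obtain ⟨e, α, he⟩ := hA.exists_eigenbasis
  refine ((Set.finite_range α).insert 0).subset fun a ha => ?_
  by_contra hmem
  obtain ⟨ha0, haα⟩ : a ≠ 0 ∧ ∀ i, α i ≠ a := by simpa using hmem
  have hKo : ∀ x ∈ Kᗮ, spectralProj A a x = 0 := fun x hx =>
    spectralProj_apply_of_eigen_of_ne hA.isSelfAdjoint (hA.apply_eq_zero_smul hx) ha0
  refine ha (ContinuousLinearMap.ext fun x => ?_)
  rw [apply_eq_sum_inner_smul hKo e x]
  refine Finset.sum_eq_zero fun i _ => ?_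
  rw [spectralProj_apply_of_eigen_of_ne hA.isSelfAdjoint (he i) (haα i).symm, smul_zero]

theorem exists_pairFunction_apply_eq_sum (hA : IsSelfAdjointIn K A) (hB : IsSelfAdjointIn K B)
    (f : Rn 2 → ℂ) {b : ℝ} {v : H} (hv : B v = (b : ℂ) • v) (a : ℝ) :
    ∃ s : Finset ℝ, a ∈ s ∧
      pairFunction f A B v = ∑ x ∈ s, f !₂[x, b] • spectralProj A x v := by
  classical
  let s := insert a hA.finite_spectralProj_ne_zero.toFinset
  let t := insert b hB.finite_spectralProj_ne_zero.toFinset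
  have hst : pairFunction f A B =
      ∑ x ∈ s, ∑ y ∈ t, f !₂[x, y] • (spectralProj A x * spectralProj B y) := by
    rw [← Finset.sum_product', pairFunction]
    refine finsum_eq_sum_of_support_subset _ ?_
    rintro ⟨x, y⟩ hxy
    have hx : spectralProj A x ≠ 0 := fun h => hxy (by simp [h])
    have hy : spectralProj B y ≠ 0 := fun h => hxy (by simp [h])
    simp [s, t, hx, hy]
  refine ⟨s, Finset.mem_insert_self _ _, ?_⟩
  simp only [hst, sum_apply, smul_apply, mul_apply_eq_comp]
  refine Finset.sum_congr rfl fun x _ => ?_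
  rw [Finset.sum_eq_single_of_mem b (Finset.mem_insert_self _ _), spectralProj_apply_of_eigen hv]
  intro y _ hy
  rw [spectralProj_apply_of_eigen_of_ne hB.isSelfAdjoint hv hy, map_zero, smul_zero]

theorem pairFunction_apply_of_eigen (hA : IsSelfAdjointIn K A) (hB : IsSelfAdjointIn K B)
    (f : Rn 2 → ℂ) {a b : ℝ} {v : H} (hva : A v = (a : ℂ) • v) (hvb : B v = (b : ℂ) • v) :
    pairFunction f A B v = f !₂[a, b] • v := by
  obtain ⟨s, ha, h⟩ := hA.exists_pairFunction_apply_eq_sum hB f hvb a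
  rw [h, Finset.sum_eq_single_of_mem a ha, spectralProj_apply_of_eigen hva]
  intro x _ hx
  rw [spectralProj_apply_of_eigen_of_ne hA.isSelfAdjoint hva hx, smul_zero]

theorem inner_pairFunction (hA : IsSelfAdjointIn K A) (hB : IsSelfAdjointIn K B) (f : Rn 2 → ℂ)
    {a b : ℝ} {u v : H} (hu : A u = (a : ℂ) • u) (hv : B v = (b : ℂ) • v) :
    inner ℂ u (pairFunction f A B v) = f !₂[a, b] * inner ℂ u v := by
  have hinner (x : ℝ) : inner ℂ u (spectralProj A x v) = inner ℂ (spectralProj A x u) v := by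
    rw [← ContinuousLinearMap.adjoint_inner_left, adjoint_spectralProj]
  obtain ⟨s, ha, h⟩ := hA.exists_pairFunction_apply_eq_sum hB f hv a
  simp only [h, inner_sum, inner_smul_right, hinner]
  rw [Finset.sum_eq_single_of_mem a ha, spectralProj_apply_of_eigen hu]
  intro x _ hx
  rw [spectralProj_apply_of_eigen_of_ne hA.isSelfAdjoint hu hx, inner_zero_left, mul_zero]

theorem inner_pairFunction_eq_sum (hA : IsSelfAdjointIn K A) (hB : IsSelfAdjointIn K B)
    (f : Rn 2 → ℂ) {ι : Type*} [Fintype ι] (g : OrthonormalBasis ι ℂ K) {γ : ι → ℝ}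
    (hg : ∀ i, A (g i) = (γ i : ℂ) • (g i : H)) {u v : H} (hu : u ∈ K) {b : ℝ}
    (hv : B v = (b : ℂ) • v) :
    inner ℂ u (pairFunction f A B v) =
      ∑ i, f !₂[γ i, b] * inner ℂ u (g i : H) * inner ℂ (g i : H) v := by
  rw [← sum_inner_mul_inner_coe g hu]
  refine Finset.sum_congr rfl fun i _ => ?_
  rw [hA.inner_pairFunction hB f (hg i) hv]
  ring

theorem pairFunction_apply_of_mem_orthogonal (hA : IsSelfAdjointIn K A)
    (hB : IsSelfAdjointIn K B) (f : Rn 2 → ℂ) {x : H} (hx : x ∈ Kᗮ) :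
    pairFunction f A B x = f !₂[0, 0] • x :=
  hA.pairFunction_apply_of_eigen hB f (hA.apply_eq_zero_smul hx) (hB.apply_eq_zero_smul hx)

theorem pairFunction_apply_mem (hA : IsSelfAdjointIn K A) (hB : IsSelfAdjointIn K B)
    (f : Rn 2 → ℂ) {x : H} (hx : x ∈ K) : pairFunction f A B x ∈ K := by
  rw [← Submodule.orthogonal_orthogonal K, Submodule.mem_orthogonal']
  intro y hy
  rw [← ContinuousLinearMap.adjoint_inner_right, adjoint_pairFunction,
    hB.pairFunction_apply_of_mem_orthogonal hA _ hy, inner_smul_right,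
    Submodule.inner_right_of_mem_orthogonal hx hy, mul_zero]

variable {A₁ B₁ A₂ B₂ : H →L[ℂ] H}

theorem pairFunction_sub_apply_eq_zero (hA₁ : IsSelfAdjointIn K A₁) (hB₁ : IsSelfAdjointIn K B₁)
    (hA₂ : IsSelfAdjointIn K A₂) (hB₂ : IsSelfAdjointIn K B₂) (f : Rn 2 → ℂ) :
    ∀ x ∈ Kᗮ, (pairFunction f A₁ B₁ - pairFunction f A₂ B₂) x = 0 := fun x hx => by
  rw [sub_apply, hA₁.pairFunction_apply_of_mem_orthogonal hB₁ f hx,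
    hA₂.pairFunction_apply_of_mem_orthogonal hB₂ f hx, sub_self]

end IsSelfAdjointIn

end PairFunction

/-! ### Schur multipliers factoring through `L²` -/

section Schur

theorem norm_integral_mul_sq_le {α : Type*} [MeasurableSpace α] {μ : Measure α} {f g : α → ℂ}
    (hf : MemLp f 2 μ) (hg : MemLp g 2 μ) :
    ‖∫ t, f t * g t ∂μ‖ ^ 2 ≤ (∫ t, ‖f t‖ ^ 2 ∂μ) * ∫ t, ‖g t‖ ^ 2 ∂μ := by
  have hholder := integral_mul_norm_le_Lp_mul_Lq (μ := μ) Real.HolderConjugate.two_two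
    (by simpa using hf) (by simpa using hg)
  have hle : ‖∫ t, f t * g t ∂μ‖ ≤ √(∫ t, ‖f t‖ ^ 2 ∂μ) * √(∫ t, ‖g t‖ ^ 2 ∂μ) := by
    simp only [Real.rpow_two, ← Real.sqrt_eq_rpow] at hholder
    refine ((norm_integral_le_integral_norm _).trans_eq ?_).trans hholder
    simp only [norm_mul]
  calc ‖∫ t, f t * g t ∂μ‖ ^ 2 ≤ (√(∫ t, ‖f t‖ ^ 2 ∂μ) * √(∫ t, ‖g t‖ ^ 2 ∂μ)) ^ 2 := by gcongr
    _ = _ := by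
      rw [mul_pow, Real.sq_sqrt (integral_nonneg fun _ => by positivity),
        Real.sq_sqrt (integral_nonneg fun _ => by positivity)]

variable {ι κ ν : Type*} [Fintype ι] [Fintype κ] [Fintype ν]

theorem sum_integral_norm_sq_sum_le {α : Type*} [MeasurableSpace α] {μ : Measure α}
    {G : ν → κ → ℂ} (hG : ∀ c : ν → ℂ, ∑ k, ‖∑ m, c m * G m k‖ ^ 2 ≤ ∑ m, ‖c m‖ ^ 2)
    {a : ν → α → ℂ} (ha : ∀ m, MemLp (a m) 2 μ) :
    ∑ k, ∫ t, ‖∑ m, a m t * G m k‖ ^ 2 ∂μ ≤ ∑ m, ∫ t, ‖a m t‖ ^ 2 ∂μ := by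
  have hsum (k) : Integrable (fun t => ‖∑ m, a m t * G m k‖ ^ 2) μ :=
    (memLp_finsetSum Finset.univ fun m _ => (ha m).mul_const (G m k)).integrable_norm_pow
      two_ne_zero
  have hsq (m) : Integrable (fun t => ‖a m t‖ ^ 2) μ := (ha m).integrable_norm_pow two_ne_zero
  rw [← integral_finsetSum _ fun k _ => hsum k, ← integral_finsetSum _ fun m _ => hsq m]
  exact integral_mono (integrable_finsetSum _ fun k _ => hsum k)
    (integrable_finsetSum _ fun m _ => hsq m) fun t => hG fun m => a m t

theorem sum_norm_sq_integral_mul_le {α : Type*} [MeasurableSpace α] {μ : Measure α}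
    {G : ν → κ → ℂ} (hG : ∀ c : ν → ℂ, ∑ k, ‖∑ m, c m * G m k‖ ^ 2 ≤ ∑ m, ‖c m‖ ^ 2)
    {a : ν → α → ℂ} {b : κ → α → ℂ} (ha : ∀ m, MemLp (a m) 2 μ) (hb : ∀ k, MemLp (b k) 2 μ)
    {Ma Mb : ℝ} (hMa : ∀ m, ∫ t, ‖a m t‖ ^ 2 ∂μ ≤ Ma) (hMb : ∀ k, ∫ t, ‖b k t‖ ^ 2 ∂μ ≤ Mb)
    (hMb0 : 0 ≤ Mb) (x : ν → ℂ) :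
    ∑ k, ‖∑ m, (∫ t, b k t * a m t ∂μ) * x m * G m k‖ ^ 2 ≤ Mb * (Ma * ∑ m, ‖x m‖ ^ 2) := by
  have hax (m) : MemLp (fun t => a m t * x m) 2 μ := (ha m).mul_const _
  have hφ (k) : MemLp (fun t => ∑ m, a m t * x m * G m k) 2 μ :=
    memLp_finsetSum _ fun m _ => (hax m).mul_const _
  have hcomb (k) : ∑ m, (∫ t, b k t * a m t ∂μ) * x m * G m k =
      ∫ t, b k t * ∑ m, a m t * x m * G m k ∂μ := by
    have hint (m) : Integrable (fun t => b k t * (a m t * x m * G m k)) μ :=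
      (hb k).integrable_mul ((hax m).mul_const _)
    simp only [Finset.mul_sum]
    rw [integral_finsetSum _ fun m _ => hint m]
    refine Finset.sum_congr rfl fun m _ => ?_
    rw [mul_assoc, ← integral_mul_const]
    simp only [mul_assoc]
  calc ∑ k, ‖∑ m, (∫ t, b k t * a m t ∂μ) * x m * G m k‖ ^ 2
      ≤ ∑ k, Mb * ∫ t, ‖∑ m, a m t * x m * G m k‖ ^ 2 ∂μ := by
        refine Finset.sum_le_sum fun k _ => ?_
        rw [hcomb]
        exact (norm_integral_mul_sq_le (hb k) (hφ k)).trans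
          (mul_le_mul_of_nonneg_right (hMb k) (integral_nonneg fun _ => by positivity))
    _ ≤ Mb * ∑ m, ∫ t, ‖a m t * x m‖ ^ 2 ∂μ := by
        rw [← Finset.mul_sum]
        exact mul_le_mul_of_nonneg_left (sum_integral_norm_sq_sum_le hG hax) hMb0
    _ ≤ Mb * (Ma * ∑ m, ‖x m‖ ^ 2) := by
        simp only [norm_mul, mul_pow, integral_mul_const, Finset.mul_sum (a := Ma)]
        gcongr with m
        exact hMa m

/-- `F(x₁, y) - F(x₂, y) = (x₁ - x₂) ∫ b(x₁, y, t) a(x₂, t) dt` with `‖a(x, ·)‖₂ ≤ 1` and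
`‖b(x, y, ·)‖₂ ≤ M`: the divided difference of `F` in its first variable is a Schur multiplier on
the Hilbert--Schmidt class. -/
def HasDividedFactor (F : ℝ → ℝ → ℂ) (M : ℝ) : Prop :=
  ∃ (a : ℝ → ℝ → ℂ) (b : ℝ → ℝ → ℝ → ℂ), (∀ x, MemLp (a x) 2) ∧ (∀ x y, MemLp (b x y) 2) ∧
    (∀ x, ∫ t, ‖a x t‖ ^ 2 ≤ 1) ∧ (∀ x y, ∫ t, ‖b x y t‖ ^ 2 ≤ M ^ 2) ∧
    ∀ x₁ x₂ y, F x₁ y - F x₂ y = (x₁ - x₂) * ∫ t, b x₁ y t * a x₂ t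

theorem HasDividedFactor.conj {F : ℝ → ℝ → ℂ} {M : ℝ} (hF : HasDividedFactor F M) :
    HasDividedFactor (fun x y => star (F x y)) M := by
  obtain ⟨a, b, ha, hb, hMa, hMb, h⟩ := hF
  refine ⟨fun x t => star (a x t), fun x y t => star (b x y t), fun x => (ha x).star,
    fun x y => (hb x y).star, by simpa using hMa, by simpa using hMb, fun x₁ x₂ y => ?_⟩
  rw [← star_sub, h]
  simp [← integral_conj]

theorem HasDividedFactor.comp_mul_left {F : ℝ → ℝ → ℂ} {M : ℝ} (hF : HasDividedFactor F M) (σ : ℝ) :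
    HasDividedFactor (fun x y => F (σ * x) y) (σ * M) := by
  obtain ⟨a, b, ha, hb, hMa, hMb, h⟩ := hF
  refine ⟨fun x => a (σ * x), fun x y t => σ * b (σ * x) y t, fun x => ha _,
    fun x y => (hb _ y).const_mul _, fun x => hMa _, fun x y => ?_, fun x₁ x₂ y => ?_⟩
  · simp only [norm_mul, mul_pow, integral_const_mul, Complex.norm_real, Real.norm_eq_abs, sq_abs]
    gcongr
    exact hMb _ _
  · simp only [h, mul_assoc, integral_const_mul]
    push_cast
    ring

theorem HasDividedFactor.norm_sub_le {F : ℝ → ℝ → ℂ} {M : ℝ} (hF : HasDividedFactor F M)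
    (hM : 0 ≤ M) (x₁ x₂ y : ℝ) : ‖F x₁ y - F x₂ y‖ ≤ M * |x₁ - x₂| := by
  obtain ⟨a, b, ha, hb, hMa, hMb, h⟩ := hF
  have hfactor : ‖∫ t, b x₁ y t * a x₂ t‖ ≤ M := by
    rw [← pow_le_pow_iff_left₀ (norm_nonneg _) hM two_ne_zero]
    calc ‖∫ t, b x₁ y t * a x₂ t‖ ^ 2
        ≤ (∫ t, ‖b x₁ y t‖ ^ 2) * ∫ t, ‖a x₂ t‖ ^ 2 := norm_integral_mul_sq_le (hb _ _) (ha _)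
      _ ≤ M ^ 2 * 1 :=
        mul_le_mul (hMb _ _) (hMa _) (integral_nonneg fun _ => by positivity) (by positivity)
      _ = M ^ 2 := mul_one _
  rw [h, norm_mul, ← Complex.ofReal_sub, Complex.norm_real, Real.norm_eq_abs, mul_comm]
  exact mul_le_mul_of_nonneg_right hfactor (abs_nonneg _)

theorem HasDividedFactor.sum_norm_sq_le {F : ℝ → ℝ → ℂ} {M : ℝ} (hF : HasDividedFactor F M)
    (α : ι → ℝ) (γ : ν → ℝ) (β : κ → ℝ) (Y : ι → ν → ℂ) {G : ν → κ → ℂ}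
    (hG : ∀ c : ν → ℂ, ∑ k, ‖∑ m, c m * G m k‖ ^ 2 ≤ ∑ m, ‖c m‖ ^ 2) :
    ∑ i, ∑ k, ‖∑ m, (F (α i) (β k) - F (γ m) (β k)) * Y i m * G m k‖ ^ 2 ≤
      M ^ 2 * ∑ i, ∑ m, ‖(α i - γ m) * Y i m‖ ^ 2 := by
  obtain ⟨a, b, ha, hb, hMa, hMb, h⟩ := hF
  rw [Finset.mul_sum]
  refine Finset.sum_le_sum fun i _ => ?_
  have hrow := sum_norm_sq_integral_mul_le hG (fun m => ha (γ m)) (fun k => hb (α i) (β k))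
    (fun m => hMa _) (fun k => hMb _ _) (sq_nonneg M) fun m => (α i - γ m) * Y i m
  rw [one_mul] at hrow
  refine le_of_eq_of_le (Finset.sum_congr rfl fun k _ => ?_) hrow
  congr 2
  refine Finset.sum_congr rfl fun m _ => ?_
  rw [h]
  ring

theorem sqrt_sum_norm_sq_le_of_hasSum {τ : Type*} {F : ℝ → ℝ → ℂ} {Fn : τ → ℝ → ℝ → ℂ}
    {Mn : τ → ℝ} (hM₀ : ∀ n, 0 ≤ Mn n) (hM : Summable Mn)
    (hFn : ∀ n, HasDividedFactor (Fn n) (Mn n))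
    (hF : ∀ x₁ x₂ y, HasSum (fun n => Fn n x₁ y - Fn n x₂ y) (F x₁ y - F x₂ y))
    (α : ι → ℝ) (γ : ν → ℝ) (β : κ → ℝ) (Y : ι → ν → ℂ) {G : ν → κ → ℂ}
    (hG : ∀ c : ν → ℂ, ∑ k, ‖∑ m, c m * G m k‖ ^ 2 ≤ ∑ m, ‖c m‖ ^ 2) :
    √(∑ i, ∑ k, ‖∑ m, (F (α i) (β k) - F (γ m) (β k)) * Y i m * G m k‖ ^ 2) ≤
      (∑' n, Mn n) * √(∑ i, ∑ m, ‖(α i - γ m) * Y i m‖ ^ 2) := by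
  let V : (ℝ → ℝ → ℂ) → EuclideanSpace ℂ (ι × κ) := fun F =>
    WithLp.toLp 2 fun ik => ∑ m, (F (α ik.1) (β ik.2) - F (γ m) (β ik.2)) * Y ik.1 m * G m ik.2
  have hV (F : ℝ → ℝ → ℂ) : ‖V F‖ =
      √(∑ i, ∑ k, ‖∑ m, (F (α i) (β k) - F (γ m) (β k)) * Y i m * G m k‖ ^ 2) := by
    rw [EuclideanSpace.norm_eq, Fintype.sum_prod_type]
  have hs : HasSum (fun n => V (Fn n)) (V F) :=
    (Pi.hasSum.2 fun ik => hasSum_sum fun m _ =>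
      ((hF (α ik.1) (γ m) (β ik.2)).mul_right _).mul_right _).mapL
        ((EuclideanSpace.equiv (ι × κ) ℂ).symm : (ι × κ → ℂ) →L[ℂ] EuclideanSpace ℂ (ι × κ))
  rw [← hV, ← hs.tsum_eq, ← tsum_mul_right]
  refine tsum_of_norm_bounded (hM.mul_right _).hasSum fun n => ?_
  rw [hV, ← Real.sqrt_sq (hM₀ n), ← Real.sqrt_mul (sq_nonneg _)]
  exact Real.sqrt_le_sqrt ((hFn n).sum_norm_sq_le α γ β Y hG)

end Schur

section HilbertSchmidtEstimate

variable {H : Type*} [NormedAddCommGroup H] [InnerProductSpace ℂ H] [CompleteSpace H]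
  {K : Submodule ℂ H} [FiniteDimensional ℂ K] {τ : Type*} {f : Rn 2 → ℂ} {fn : τ → Rn 2 → ℂ}
  {Mn : τ → ℝ}

theorem schattenNorm_two_pairFunction_sub_left_le (hM₀ : ∀ n, 0 ≤ Mn n) (hM : Summable Mn)
    (hfn : ∀ n, HasDividedFactor (fun x y => fn n !₂[x, y]) (Mn n))
    (hf : ∀ x y, HasSum (fun n => fn n x - fn n y) (f x - f y)) {A₁ A₂ B : H →L[ℂ] H}
    (hA₁ : IsSelfAdjointIn K A₁) (hA₂ : IsSelfAdjointIn K A₂) (hB : IsSelfAdjointIn K B) :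
    schattenNorm 2 (pairFunction f A₁ B - pairFunction f A₂ B) ≤
      ENNReal.ofReal (∑' n, Mn n) * schattenNorm 2 (A₁ - A₂) := by
  obtain ⟨e, α, he⟩ := hA₁.exists_eigenbasis
  obtain ⟨g, γ, hg⟩ := hA₂.exists_eigenbasis
  obtain ⟨h, β, hh⟩ := hB.exists_eigenbasis
  have hentryA (i m) : inner ℂ (e i : H) ((A₁ - A₂) (g m)) =
      (α i - γ m) * inner ℂ (e i : H) (g m : H) := by
    rw [sub_apply, inner_sub_right, inner_apply_of_eigen hA₁.isSelfAdjoint (he i), hg,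
      inner_smul_right, sub_mul]
  have hentryf (i k) :
      inner ℂ (e i : H) ((pairFunction f A₁ B - pairFunction f A₂ B) (h k)) =
        ∑ m, (f !₂[α i, β k] - f !₂[γ m, β k]) * inner ℂ (e i : H) (g m : H) *
          inner ℂ (g m : H) (h k : H) := by
    rw [sub_apply, inner_sub_right, hA₂.inner_pairFunction_eq_sum hB f g hg (e i).2 (hh k),
      hA₁.inner_pairFunction hB f (he i) (hh k), ← sum_inner_mul_inner_coe g (e i).2,
      Finset.mul_sum, ← Finset.sum_sub_distrib]
    simp only [sub_mul, mul_assoc]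
  rw [schattenNorm_two_eq_sum_inner (hA₁.pairFunction_sub_apply_eq_zero hB hA₂ hB f)
      (fun x hx => K.sub_mem (hA₁.pairFunction_apply_mem hB f hx)
        (hA₂.pairFunction_apply_mem hB f hx)) e h,
    schattenNorm_two_eq_sum_inner (hA₁.sub_apply_eq_zero hA₂)
      (fun x _ => K.sub_mem (hA₁.apply_mem x) (hA₂.apply_mem x)) e g,
    ← ENNReal.ofReal_mul (tsum_nonneg hM₀)]
  simp only [hentryA, hentryf]
  exact ENNReal.ofReal_le_ofReal <| sqrt_sum_norm_sq_le_of_hasSum (F := fun x y => f !₂[x, y]) hM₀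
    hM hfn (fun _ _ _ => hf _ _) α γ β _ fun c => (sum_norm_sq_sum_mul_inner_coe g h c).le

theorem schattenNorm_two_pairFunction_sub_right_le (hM₀ : ∀ n, 0 ≤ Mn n) (hM : Summable Mn)
    (hfn : ∀ n, HasDividedFactor (fun y x => fn n !₂[x, y]) (Mn n))
    (hf : ∀ x y, HasSum (fun n => fn n x - fn n y) (f x - f y)) {A B₁ B₂ : H →L[ℂ] H}
    (hA : IsSelfAdjointIn K A) (hB₁ : IsSelfAdjointIn K B₁) (hB₂ : IsSelfAdjointIn K B₂) :
    schattenNorm 2 (pairFunction f A B₁ - pairFunction f A B₂) ≤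
      ENNReal.ofReal (∑' n, Mn n) * schattenNorm 2 (B₁ - B₂) := by
  rw [← schattenNorm_adjoint, map_sub, adjoint_pairFunction, adjoint_pairFunction]
  refine schattenNorm_two_pairFunction_sub_left_le (fn := fun n x => star (fn n !₂[x 1, x 0])) hM₀
    hM (fun n => (hfn n).conj) (fun x y => ?_) hB₁ hB₂ hA
  simpa only [star_sub] using (hf _ _).star

theorem schattenNorm_two_pairFunction_sub_le (hM₀ : ∀ n, 0 ≤ Mn n) (hM : Summable Mn)
    (hfn : ∀ n, HasDividedFactor (fun x y => fn n !₂[x, y]) (Mn n))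
    (hfn' : ∀ n, HasDividedFactor (fun y x => fn n !₂[x, y]) (Mn n))
    (hf : ∀ x y, HasSum (fun n => fn n x - fn n y) (f x - f y)) {A₁ B₁ A₂ B₂ : H →L[ℂ] H}
    (hA₁ : IsSelfAdjointIn K A₁) (hB₁ : IsSelfAdjointIn K B₁) (hA₂ : IsSelfAdjointIn K A₂)
    (hB₂ : IsSelfAdjointIn K B₂) :
    schattenNorm 2 (pairFunction f A₁ B₁ - pairFunction f A₂ B₂) ≤
      ENNReal.ofReal (∑' n, Mn n) * (schattenNorm 2 (A₁ - A₂) + schattenNorm 2 (B₁ - B₂)) := by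
  rw [← sub_add_sub_cancel (pairFunction f A₁ B₁) (pairFunction f A₂ B₁), mul_add]
  exact (schattenNorm_two_add_le (hA₁.pairFunction_sub_apply_eq_zero hB₁ hA₂ hB₁ f)
    (hA₂.pairFunction_sub_apply_eq_zero hB₁ hA₂ hB₂ f)).trans <| add_le_add
      (schattenNorm_two_pairFunction_sub_left_le hM₀ hM hfn hf hA₁ hA₂ hB₁)
      (schattenNorm_two_pairFunction_sub_right_le hM₀ hM hfn' hf hA₂ hB₁ hB₂)

theorem two_mul_rpow_half_sub_inv_le {p : ℝ≥0∞} (hp : 2 ≤ p) (x : ℝ≥0∞) :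
    (2 * x) ^ ((1 : ℝ) / 2 - 1 / p.toReal) ≤ 2 * x ^ ((1 : ℝ) / 2 - 1 / p.toReal) := by
  have hq0 : 0 ≤ (1 : ℝ) / 2 - 1 / p.toReal := by
    obtain rfl | hp' := eq_or_ne p ⊤
    · simp
    · have : 2 ≤ p.toReal := by simpa using ENNReal.toReal_mono hp' hp
      exact sub_nonneg.2 (one_div_le_one_div_of_le two_pos this)
  have hq1 : (1 : ℝ) / 2 - 1 / p.toReal ≤ 1 := by
    have : 0 ≤ 1 / p.toReal := by positivity
    linarith
  rw [ENNReal.mul_rpow_of_nonneg _ _ hq0]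
  gcongr
  exact (ENNReal.rpow_le_rpow_of_exponent_le one_le_two hq1).trans_eq (ENNReal.rpow_one 2)

theorem schattenNorm_pairFunction_sub_le (hM₀ : ∀ n, 0 ≤ Mn n) (hM : Summable Mn)
    (hfn : ∀ n, HasDividedFactor (fun x y => fn n !₂[x, y]) (Mn n))
    (hfn' : ∀ n, HasDividedFactor (fun y x => fn n !₂[x, y]) (Mn n))
    (hf : ∀ x y, HasSum (fun n => fn n x - fn n y) (f x - f y)) {p : ℝ≥0∞} (hp : 2 ≤ p) {N : ℕ}
    {A₁ B₁ A₂ B₂ : H →L[ℂ] H} (hA₁ : IsSelfAdjoint A₁) (hB₁ : IsSelfAdjoint B₁)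
    (hA₂ : IsSelfAdjoint A₂) (hB₂ : IsSelfAdjoint B₂) (hA₁N : RankLE A₁ N) (hB₁N : RankLE B₁ N)
    (hA₂N : RankLE A₂ N) (hB₂N : RankLE B₂ N) :
    schattenNorm p (pairFunction f A₁ B₁ - pairFunction f A₂ B₂) ≤
      4 * ENNReal.ofReal (∑' n, Mn n) * (N : ℝ≥0∞) ^ ((1 : ℝ) / 2 - 1 / p.toReal) *
        max (schattenNorm p (A₁ - A₂)) (schattenNorm p (B₁ - B₂)) := by
  obtain ⟨K, hK, hmem⟩ := exists_finiteDimensional_forall_apply_mem (A := ![A₁, B₁, A₂, B₂])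
    (n := N) (by simp [Fin.forall_fin_succ, *])
  have hS₂ := schattenNorm_two_pairFunction_sub_le hM₀ hM hfn hfn' hf ⟨hA₁, hmem 0⟩ ⟨hB₁, hmem 1⟩
    ⟨hA₂, hmem 2⟩ ⟨hB₂, hmem 3⟩
  set q := (1 : ℝ) / 2 - 1 / p.toReal
  set m := max (schattenNorm p (A₁ - A₂)) (schattenNorm p (B₁ - B₂))
  have hrank {S T : H →L[ℂ] H} (hS : RankLE S N) (hT : RankLE T N)
      (hm : schattenNorm p (S - T) ≤ m) : schattenNorm 2 (S - T) ≤ 2 * (N : ℝ≥0∞) ^ q * m := by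
    refine (schattenNorm_le_rank_rpow_mul two_ne_zero hp (hS.sub hT)).trans (mul_le_mul' ?_ hm)
    rw [← two_mul, Nat.cast_mul]
    exact two_mul_rpow_half_sub_inv_le hp N
  calc schattenNorm p (pairFunction f A₁ B₁ - pairFunction f A₂ B₂)
      ≤ schattenNorm 2 (pairFunction f A₁ B₁ - pairFunction f A₂ B₂) :=
        schattenNorm_anti two_ne_zero hp _
    _ ≤ ENNReal.ofReal (∑' n, Mn n) * (2 * (N : ℝ≥0∞) ^ q * m + 2 * (N : ℝ≥0∞) ^ q * m) := by
        refine hS₂.trans ?_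
        gcongr
        · exact hrank hA₁N hA₂N (le_max_left _ _)
        · exact hrank hB₁N hB₂N (le_max_right _ _)
    _ = 4 * ENNReal.ofReal (∑' n, Mn n) * (N : ℝ≥0∞) ^ q * m := by ring

end HilbertSchmidtEstimate

/-! ### Divided differences of band-limited functions -/

section Reproducing

variable {K : 𝓢(ℝ, ℂ)} {g : ℝ → ℂ} {M : ℝ}

/-- A bounded function `g` such that `g` and all its contractions `s ↦ g (c + θ s)`, `0 ≤ θ ≤ 1`,
are fixed by convolution with `K`. Bounded functions with spectrum in `[-1, 1]` have this property
as soon as `𝓕 K = 1` on `[-1, 1]`. -/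
structure IsReproduced (K : 𝓢(ℝ, ℂ)) (g : ℝ → ℂ) (M : ℝ) : Prop where
  measurable : Measurable g
  bound : ∀ s, ‖g s‖ ≤ M
  integral_eq : ∀ θ ∈ Set.Icc (0 : ℝ) 1, ∀ c s, ∫ r, g (c + θ * (s - r)) * K r = g (c + θ * s)

/-- The derivative of a function `g` with `g = g * K`, in the form `g * K'`. -/
def reproducedDeriv (K : 𝓢(ℝ, ℂ)) (g : ℝ → ℂ) (u : ℝ) : ℂ := ∫ t, g (u - t) * deriv K t

/-- The divided difference `(g s - g x) / (s - x)` of a function with `g = g * K`, extended to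
`s = x` as the mean of the derivative over the segment between `x` and `s`. -/
def reproducedDivDiff (K : 𝓢(ℝ, ℂ)) (g : ℝ → ℂ) (x s : ℝ) : ℂ :=
  ∫ θ in (0 : ℝ)..1, reproducedDeriv K g (x + θ * (s - x))

theorem integrable_deriv_schwartz (K : 𝓢(ℝ, ℂ)) : Integrable (deriv K) :=
  (SchwartzMap.derivCLM ℂ ℂ K).integrable

theorem continuous_deriv_schwartz (K : 𝓢(ℝ, ℂ)) : Continuous (deriv K) :=
  (SchwartzMap.derivCLM ℂ ℂ K).continuous

namespace IsReproduced

theorem stronglyMeasurable_deriv (hg : IsReproduced K g M) :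
    StronglyMeasurable (reproducedDeriv K g) := by
  have h : StronglyMeasurable fun p : ℝ × ℝ => g (p.1 - p.2) * deriv K p.2 :=
    ((hg.measurable.comp (measurable_fst.sub measurable_snd)).mul
      ((continuous_deriv_schwartz K).measurable.comp measurable_snd)).stronglyMeasurable
  exact h.integral_prod_right

theorem norm_deriv_le (hg : IsReproduced K g M) (u : ℝ) :
    ‖reproducedDeriv K g u‖ ≤ M * ∫ t, ‖deriv K t‖ := by
  rw [← integral_const_mul]
  refine norm_integral_le_of_norm_le ((integrable_deriv_schwartz K).norm.const_mul M) (.of_forall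
    fun t => ?_)
  rw [norm_mul]
  exact mul_le_mul_of_nonneg_right (hg.bound _) (norm_nonneg _)

theorem eq_integral (hg : IsReproduced K g M) (s : ℝ) : g s = ∫ t, g t * K (s - t) := by
  rw [← integral_sub_left_eq_self _ volume s]
  simpa using (hg.integral_eq 1 ⟨zero_le_one, le_rfl⟩ 0 s).symm

theorem integrable_mul_deriv_prod (hg : IsReproduced K g M) (x s : ℝ) :
    Integrable (fun p : ℝ × ℝ => g p.2 * deriv K (p.1 - p.2))
      ((volume.restrict (Set.uIoc x s)).prod volume) := by
  have : IsFiniteMeasure (volume.restrict (Set.uIoc x s)) := by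
    unfold Set.uIoc; infer_instance
  have hneg : Integrable fun t => deriv K (-t) := (integrable_deriv_schwartz K).comp_neg
  have hprod : Integrable (fun p : ℝ × ℝ => deriv K (p.1 - p.2))
      ((volume.restrict (Set.uIoc x s)).prod volume) := by
    simpa [Function.comp_def] using ((integrable_const (1 : ℂ)).convolution_integrand
      (ContinuousLinearMap.mul ℂ ℂ) hneg).swap
  exact hprod.bdd_mul (hg.measurable.comp measurable_snd).aestronglyMeasurable
    (.of_forall fun p => hg.bound _)

theorem sub_eq_integral_deriv (hg : IsReproduced K g M) (x s : ℝ) :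
    g s - g x = ∫ u in x..s, reproducedDeriv K g u := by
  have hint (s) : Integrable fun t => g t * K (s - t) :=
    (K.integrable.comp_sub_left s).bdd_mul hg.measurable.aestronglyMeasurable (.of_forall hg.bound)
  have hftc (t) : ∫ u in x..s, deriv K (u - t) = K (s - t) - K (x - t) := by
    rw [intervalIntegral.integral_comp_sub_right (fun u => deriv K u) t,
      intervalIntegral.integral_deriv_eq_sub (fun y _ => K.differentiableAt)
        ((continuous_deriv_schwartz K).intervalIntegrable _ _)]
  calc g s - g x = ∫ t, (g t * K (s - t) - g t * K (x - t)) := by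
        rw [integral_sub (hint s) (hint x), ← hg.eq_integral, ← hg.eq_integral]
    _ = ∫ t, ∫ u in x..s, g t * deriv K (u - t) := by
        simp only [intervalIntegral.integral_const_mul, hftc, mul_sub]
    _ = ∫ u in x..s, ∫ t, g t * deriv K (u - t) :=
        (intervalIntegral_integral_swap (hg.integrable_mul_deriv_prod x s)).symm
    _ = ∫ u in x..s, reproducedDeriv K g u := by
        refine intervalIntegral.integral_congr fun u _ => ?_
        rw [reproducedDeriv, ← integral_sub_left_eq_self _ volume u]
        simp only [sub_sub_cancel]

theorem integral_deriv_mul (hg : IsReproduced K g M) {θ : ℝ} (hθ : θ ∈ Set.Icc (0 : ℝ) 1)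
    (c s : ℝ) :
    ∫ r, reproducedDeriv K g (c + θ * (s - r)) * K r = reproducedDeriv K g (c + θ * s) := by
  have hint : Integrable (fun p : ℝ × ℝ => g (c + θ * (s - p.1) - p.2) * (K p.1 * deriv K p.2))
      (volume.prod volume) :=
    (K.integrable.mul_prod (integrable_deriv_schwartz K)).bdd_mul
      (hg.measurable.comp (by fun_prop)).aestronglyMeasurable (.of_forall fun p => hg.bound _)
  calc ∫ r, reproducedDeriv K g (c + θ * (s - r)) * K r
      = ∫ r, ∫ t, g (c + θ * (s - r) - t) * (K r * deriv K t) := by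
        simp only [reproducedDeriv, ← integral_mul_const, mul_assoc, mul_comm (K _)]
    _ = ∫ t, ∫ r, g (c - t + θ * (s - r)) * K r * deriv K t := by
        rw [integral_integral_swap hint]
        simp only [mul_assoc, add_sub_right_comm]
    _ = reproducedDeriv K g (c + θ * s) := by
        simp only [integral_mul_const, hg.integral_eq θ hθ, reproducedDeriv, add_sub_right_comm]

theorem sub_mul_divDiff (hg : IsReproduced K g M) (x s : ℝ) :
    (s - x : ℂ) * reproducedDivDiff K g x s = g s - g x := by
  have hsubst := intervalIntegral.smul_integral_comp_add_mul (a := 0) (b := 1)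
    (reproducedDeriv K g) (s - x) x
  rw [hg.sub_eq_integral_deriv, reproducedDivDiff, ← Complex.ofReal_sub, ← Complex.real_smul]
  simpa only [mul_comm (s - x), zero_mul, add_zero, one_mul, add_sub_cancel] using hsubst

theorem norm_divDiff_le (hg : IsReproduced K g M) (x s : ℝ) :
    ‖reproducedDivDiff K g x s‖ ≤ M * ∫ t, ‖deriv K t‖ := by
  simpa [reproducedDivDiff] using intervalIntegral.norm_integral_le_of_norm_le_const (a := (0 : ℝ))
    (b := 1) fun θ _ => hg.norm_deriv_le (x + θ * (s - x))

theorem stronglyMeasurable_divDiff (hg : IsReproduced K g M) (x : ℝ) :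
    StronglyMeasurable (reproducedDivDiff K g x) := by
  have h : StronglyMeasurable fun p : ℝ × ℝ => reproducedDeriv K g (x + p.2 * (p.1 - x)) :=
    (hg.stronglyMeasurable_deriv.measurable.comp (by fun_prop)).stronglyMeasurable
  unfold reproducedDivDiff
  simpa only [intervalIntegral.integral_of_le zero_le_one] using
    h.integral_prod_right' (ν := volume.restrict (Set.Ioc (0 : ℝ) 1))

theorem divDiff_eq_integral (hg : IsReproduced K g M) (x s : ℝ) :
    reproducedDivDiff K g x s = ∫ t, reproducedDivDiff K g x t * K (s - t) := by
  have : IsFiniteMeasure (volume.restrict (Set.uIoc (0 : ℝ) 1)) := by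
    unfold Set.uIoc; infer_instance
  have hint : Integrable (fun p : ℝ × ℝ => reproducedDeriv K g (x + p.1 * (s - p.2 - x)) * K p.2)
      ((volume.restrict (Set.uIoc 0 1)).prod volume) :=
    (K.integrable.comp_snd _).bdd_mul
      (hg.stronglyMeasurable_deriv.measurable.comp (by fun_prop)).aestronglyMeasurable
      (.of_forall fun p => hg.norm_deriv_le _)
  have hfix (θ) (hθ : θ ∈ Set.uIcc (0 : ℝ) 1) :
      ∫ r, reproducedDeriv K g (x + θ * (s - r - x)) * K r =
        reproducedDeriv K g (x + θ * (s - x)) := by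
    rw [Set.uIcc_of_le zero_le_one] at hθ
    have hshift (r) : x + θ * (r - x) = x - θ * x + θ * r := by ring
    simpa only [hshift] using hg.integral_deriv_mul hθ (x - θ * x) s
  symm
  calc ∫ t, reproducedDivDiff K g x t * K (s - t)
      = ∫ r, reproducedDivDiff K g x (s - r) * K r := by
        rw [← integral_sub_left_eq_self _ volume s]; simp only [sub_sub_cancel]
    _ = ∫ r, ∫ θ in (0 : ℝ)..1, reproducedDeriv K g (x + θ * (s - r - x)) * K r := by
        simp only [reproducedDivDiff, intervalIntegral.integral_mul_const]
    _ = ∫ θ in (0 : ℝ)..1, ∫ r, reproducedDeriv K g (x + θ * (s - r - x)) * K r :=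
        (intervalIntegral_integral_swap hint).symm
    _ = reproducedDivDiff K g x s := intervalIntegral.integral_congr hfix

theorem norm_divDiff_sq_le (hg : IsReproduced K g M) (x s : ℝ) :
    ‖reproducedDivDiff K g x s‖ ^ 2 ≤
      M ^ 2 * ((∫ t, ‖deriv K t‖) ^ 2 + 4) * (1 + (s - x) ^ 2)⁻¹ := by
  have hnear := pow_le_pow_left₀ (norm_nonneg _) (hg.norm_divDiff_le x s) 2
  have hfar : (|s - x| * ‖reproducedDivDiff K g x s‖) ^ 2 ≤ (2 * M) ^ 2 := by
    refine pow_le_pow_left₀ (by positivity) ?_ 2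
    calc |s - x| * ‖reproducedDivDiff K g x s‖ = ‖g s - g x‖ := by
          rw [← hg.sub_mul_divDiff, norm_mul, ← Complex.ofReal_sub, Complex.norm_real,
            Real.norm_eq_abs]
      _ ≤ 2 * M := by linarith [norm_sub_le (g s) (g x), hg.bound s, hg.bound x]
  rw [← div_eq_mul_inv, le_div_iff₀ (by positivity)]
  rw [mul_pow, sq_abs] at hfar
  linarith

theorem memLp_divDiff (hg : IsReproduced K g M) (x : ℝ) : MemLp (reproducedDivDiff K g x) 2 := by
  rw [memLp_two_iff_integrable_sq_norm (hg.stronglyMeasurable_divDiff x).aestronglyMeasurable]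
  refine ((integrable_inv_one_add_sq.comp_sub_right x).const_mul
    (M ^ 2 * ((∫ t, ‖deriv K t‖) ^ 2 + 4))).mono'
    ((hg.stronglyMeasurable_divDiff x).norm.pow 2).aestronglyMeasurable (.of_forall fun s => ?_)
  rw [Real.norm_of_nonneg (by positivity)]
  exact hg.norm_divDiff_sq_le x s

theorem integral_norm_divDiff_sq_le (hg : IsReproduced K g M) (x : ℝ) :
    ∫ s, ‖reproducedDivDiff K g x s‖ ^ 2 ≤
      M ^ 2 * ((∫ t, ‖deriv K t‖) ^ 2 + 4) * Real.pi := by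
  rw [← integral_univ_inv_one_add_sq, ← integral_sub_right_eq_self (fun s : ℝ => (1 + s ^ 2)⁻¹) x,
    ← integral_const_mul]
  exact integral_mono ((hg.memLp_divDiff x).integrable_norm_pow two_ne_zero)
    ((integrable_inv_one_add_sq.comp_sub_right x).const_mul _) (hg.norm_divDiff_sq_le x)

end IsReproduced

theorem exists_hasDividedFactor_of_isReproduced (K : 𝓢(ℝ, ℂ)) : ∃ C : ℝ, 0 ≤ C ∧
    ∀ (F : ℝ → ℝ → ℂ) (M : ℝ), (∀ y, IsReproduced K (fun s => F s y) M) →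
      HasDividedFactor F (C * M) := by
  set κ := (∫ t, ‖K t‖ ^ 2) + 1
  have hκ : 0 < κ := by positivity
  have hκC : (√κ : ℂ) ≠ 0 := by exact_mod_cast (Real.sqrt_pos.2 hκ).ne'
  set D := ((∫ t, ‖deriv K t‖) ^ 2 + 4) * Real.pi with hD
  refine ⟨√κ * √D, by positivity, fun F M hF => ⟨fun x t => (√κ : ℂ)⁻¹ * K (x - t),
    fun x y t => √κ * reproducedDivDiff K (fun s => F s y) x t, fun x => ?_,
    fun x y => ((hF y).memLp_divDiff _).const_mul _, fun x => ?_, fun x y => ?_,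
    fun x₁ x₂ y => ?_⟩⟩
  · exact ((K.memLp 2).comp_measurePreserving
      (Measure.measurePreserving_sub_left volume x)).const_mul _
  · simp only [norm_mul, mul_pow, integral_const_mul, norm_inv, Complex.norm_real, inv_pow,
      Real.norm_eq_abs, sq_abs, Real.sq_sqrt hκ.le]
    rw [integral_sub_left_eq_self (fun t => ‖K t‖ ^ 2) volume x, inv_mul_le_iff₀ hκ, mul_one]
    exact le_add_of_nonneg_right zero_le_one
  · simp only [norm_mul, mul_pow, integral_const_mul, Complex.norm_real, Real.norm_eq_abs, sq_abs]
    rw [Real.sq_sqrt hκ.le, Real.sq_sqrt (by positivity), mul_assoc]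
    gcongr
    exact ((hF y).integral_norm_divDiff_sq_le x).trans_eq (by rw [hD]; ring)
  · have hcancel (t) : √κ * reproducedDivDiff K (fun s => F s y) x₁ t * ((√κ : ℂ)⁻¹ * K (x₂ - t)) =
        reproducedDivDiff K (fun s => F s y) x₁ t * K (x₂ - t) := by field_simp
    simp only [hcancel]
    rw [← (hF y).divDiff_eq_integral]
    linear_combination (hF y).sub_mul_divDiff x₁ x₂

end Reproducing

/-! ### Convolutions of distributions with band-limited kernels -/

section Cutoff

theorem norm_pow_le_one_add_norm_pow_mul {E : Type*} [SeminormedAddCommGroup E] (x z : E)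
    (k : ℕ) : ‖z‖ ^ k ≤ (1 + ‖x‖) ^ k * (1 + ‖z - x‖) ^ k := by
  rw [← mul_pow]
  gcongr
  nlinarith [norm_le_norm_sub_add z x, norm_nonneg x, norm_nonneg (z - x)]

theorem one_add_norm_sub_apply_le {E V : Type*} [SeminormedAddCommGroup E] [NormedSpace ℝ E]
    [SeminormedAddCommGroup V] [NormedSpace ℝ V] (L : E →L[ℝ] V) (x : V) (r : E) :
    1 + ‖x - L r‖ ≤ (1 + ‖x‖) * (1 + ‖L‖) * (1 + ‖r‖) := by
  calc 1 + ‖x - L r‖ ≤ 1 + (‖x‖ + ‖L‖ * ‖r‖) := by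
        gcongr
        exact (norm_sub_le _ _).trans (by gcongr; exact L.le_opNorm r)
    _ ≤ 1 + (‖x‖ + ‖L‖ * ‖r‖) + (‖L‖ + ‖r‖ + ‖x‖ * ‖L‖ + ‖x‖ * ‖r‖ + ‖x‖ * ‖L‖ * ‖r‖) :=
        le_add_of_nonneg_right (by positivity)
    _ = (1 + ‖x‖) * (1 + ‖L‖) * (1 + ‖r‖) := by ring

variable {E : Type*} [NormedAddCommGroup E] [NormedSpace ℝ E]

/-- The cut off translate `z ↦ χ (c z) η (z - x)`. -/
def cutoffTranslate (χ η : 𝓢(E, ℂ)) (c : ℝ) (x : E) : 𝓢(E, ℂ) :=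
  SchwartzMap.smulLeftCLM ℂ (fun z => χ (c • z)) (η.compSubConstCLM ℂ x)

theorem cutoffTranslate_apply (χ η : 𝓢(E, ℂ)) (c : ℝ) (x z : E) :
    cutoffTranslate χ η c x z = χ (c • z) * η (z - x) := by
  have hχ : Function.HasTemperateGrowth fun z : E => χ (c • z) :=
    χ.hasTemperateGrowth.comp (c • ContinuousLinearMap.id ℝ E).hasTemperateGrowth
  rw [cutoffTranslate, SchwartzMap.smulLeftCLM_apply_apply hχ, smul_eq_mul,
    SchwartzMap.compSubConstCLM_apply]

theorem norm_iteratedFDeriv_comp_smul_le (χ : 𝓢(E, ℂ)) {c : ℝ} (hc : |c| ≤ 1) (j : ℕ) (z : E) :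
    ‖iteratedFDeriv ℝ j (fun z => χ (c • z)) z‖ ≤ SchwartzMap.seminorm ℝ 0 j χ := by
  have hnorm : ‖c • ContinuousLinearMap.id ℝ E‖ ≤ 1 := by
    rw [norm_smul, Real.norm_eq_abs]
    exact mul_le_one₀ hc (norm_nonneg _) ContinuousLinearMap.norm_id_le
  change ‖iteratedFDeriv ℝ j (χ ∘ (c • ContinuousLinearMap.id ℝ E)) z‖ ≤ _
  rw [(c • ContinuousLinearMap.id ℝ E).iteratedFDeriv_comp_right (χ.smooth ⊤) z
    (by exact_mod_cast le_top)]
  exact (ContinuousMultilinearMap.norm_compContinuousLinearMap_le _ _).trans <|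
    (mul_le_of_le_one_right (norm_nonneg _) (Finset.prod_le_one (fun _ _ => norm_nonneg _)
      fun _ _ => hnorm)).trans (SchwartzMap.norm_iteratedFDeriv_le_seminorm ℝ χ j _)

theorem exists_seminorm_cutoffTranslate_le (χ η : 𝓢(E, ℂ)) (k l : ℕ) :
    ∃ C : ℝ, ∀ (c : ℝ) (x : E), |c| ≤ 1 →
      SchwartzMap.seminorm ℂ k l (cutoffTranslate χ η c x) ≤ C * (1 + ‖x‖) ^ k := by
  have hdecay (m : ℕ) : ∃ D, ∀ x, (1 + ‖x‖) ^ k * ‖iteratedFDeriv ℝ m η x‖ ≤ D :=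
    ⟨_, fun x => SchwartzMap.one_add_le_sup_seminorm_apply (𝕜 := ℝ) (m := (k, m)) le_rfl le_rfl η x⟩
  choose D hD using hdecay
  have hD₀ (m) : 0 ≤ D m := (by positivity : (0 : ℝ) ≤ _).trans (hD m 0)
  refine ⟨∑ i ∈ Finset.range (l + 1), (l.choose i : ℝ) * SchwartzMap.seminorm ℝ 0 i χ * D (l - i),
    fun c x hc => SchwartzMap.seminorm_le_bound ℂ k l _ ?_ fun z => ?_⟩
  · exact mul_nonneg (Finset.sum_nonneg fun i _ => mul_nonneg (by positivity) (hD₀ _))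
      (by positivity)
  have hχ : ContDiff ℝ ∞ fun z : E => χ (c • z) := (χ.smooth ⊤).comp (contDiff_const_smul c)
  have hη : ContDiff ℝ ∞ fun z : E => η (z - x) :=
    (η.smooth ⊤).comp (contDiff_id.sub contDiff_const)
  rw [funext (cutoffTranslate_apply χ η c x)]
  calc ‖z‖ ^ k * ‖iteratedFDeriv ℝ l (fun z => χ (c • z) * η (z - x)) z‖
      ≤ ((1 + ‖x‖) ^ k * (1 + ‖z - x‖) ^ k) * ∑ i ∈ Finset.range (l + 1), (l.choose i : ℝ) *
          ‖iteratedFDeriv ℝ i (fun z => χ (c • z)) z‖ *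
          ‖iteratedFDeriv ℝ (l - i) (fun z => η (z - x)) z‖ := by
        gcongr
        · exact norm_pow_le_one_add_norm_pow_mul x z k
        · exact norm_iteratedFDeriv_mul_le hχ hη z (by exact_mod_cast le_top)
    _ = (∑ i ∈ Finset.range (l + 1), (l.choose i : ℝ) *
          ‖iteratedFDeriv ℝ i (fun z => χ (c • z)) z‖ *
          ((1 + ‖z - x‖) ^ k * ‖iteratedFDeriv ℝ (l - i) η (z - x)‖)) * (1 + ‖x‖) ^ k := by
        simp only [iteratedFDeriv_comp_sub, Finset.mul_sum, Finset.sum_mul]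
        exact Finset.sum_congr rfl fun i _ => by ring
    _ ≤ _ := by
        gcongr with i _
        · exact norm_iteratedFDeriv_comp_smul_le χ hc i z
        · exact hD _ _

theorem exists_norm_apply_cutoffTranslate_le (F : 𝓢'(E, ℂ)) (χ η : 𝓢(E, ℂ)) :
    ∃ (C : ℝ) (k : ℕ), 0 ≤ C ∧ ∀ (c : ℝ) (x : E), |c| ≤ 1 →
      ‖F (cutoffTranslate χ η c x)‖ ≤ C * (1 + ‖x‖) ^ k := by
  let q : Seminorm ℂ 𝓢(E, ℂ) := (normSeminorm ℂ ℂ).comp (F : 𝓢(E, ℂ) →ₗ[ℂ] ℂ)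
  obtain ⟨s, B, -, hB⟩ := Seminorm.bound_of_continuous (schwartz_withSeminorms ℂ E ℂ) q
    (continuous_norm.comp F.cont)
  choose D hD using fun m : ℕ × ℕ => exists_seminorm_cutoffTranslate_le χ η m.1 m.2
  have hD₀ (m) : 0 ≤ D m := by
    simpa using (apply_nonneg _ _).trans (hD m 0 0 (by simp))
  refine ⟨B * ∑ m ∈ s, D m, s.sup Prod.fst, mul_nonneg B.2 (Finset.sum_nonneg fun m _ => hD₀ m),
    fun c x hc => ?_⟩
  calc ‖F (cutoffTranslate χ η c x)‖
      ≤ B * (s.sup (schwartzSeminormFamily ℂ E ℂ)) (cutoffTranslate χ η c x) := hB _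
    _ ≤ B * ∑ m ∈ s, schwartzSeminormFamily ℂ E ℂ m (cutoffTranslate χ η c x) := by
        gcongr
        exact Seminorm.finset_sup_apply_le (Finset.sum_nonneg fun m _ => apply_nonneg _ _)
          fun m hm => Finset.single_le_sum (f := fun m => schwartzSeminormFamily ℂ E ℂ m _)
            (fun m _ => apply_nonneg _ _) hm
    _ ≤ B * ((∑ m ∈ s, D m) * (1 + ‖x‖) ^ s.sup Prod.fst) := by
        rw [Finset.sum_mul]
        gcongr with m hm
        refine (hD m c x hc).trans (mul_le_mul_of_nonneg_left ?_ (hD₀ m))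
        exact pow_le_pow_right₀ (by linarith [norm_nonneg x]) (Finset.le_sup (f := Prod.fst) hm)
    _ = B * (∑ m ∈ s, D m) * (1 + ‖x‖) ^ s.sup Prod.fst := (mul_assoc _ _ _).symm

theorem integrable_one_add_norm_pow_mul [MeasurableSpace E] [BorelSpace E]
    [SecondCountableTopology E] (μ : Measure E) [μ.HasTemperateGrowth] (K : 𝓢(E, ℂ)) (k : ℕ) :
    Integrable (fun r => (1 + ‖r‖) ^ k * ‖K r‖) μ := by
  simp only [add_comm (1 : ℝ), add_pow, one_pow, mul_one, Finset.sum_mul]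
  exact integrable_finsetSum _ fun m _ => by
    simpa only [mul_right_comm] using (K.integrable_pow_mul μ m).mul_const _

theorem exists_schwartz_eq_one (E : Type*) [NormedAddCommGroup E] [NormedSpace ℝ E]
    [FiniteDimensional ℝ E] : ∃ χ : 𝓢(E, ℂ), ∀ x, ‖x‖ ≤ 1 → χ x = 1 := by
  let b : ContDiffBump (0 : E) := ⟨1, 2, one_pos, one_lt_two⟩
  have hsupp : HasCompactSupport fun x => (b x : ℂ) :=
    b.hasCompactSupport.comp_left (g := Complex.ofReal) Complex.ofReal_zero
  have hsmooth : ContDiff ℝ ∞ fun x => (b x : ℂ) := Complex.ofRealCLM.contDiff.comp b.contDiff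
  refine ⟨hsupp.toSchwartzMap hsmooth, fun x hx => ?_⟩
  change (b x : ℂ) = 1
  rw [b.one_of_mem_closedBall (by simpa [b] using hx), Complex.ofReal_one]

end Cutoff

section DistConv

variable {d : ℕ} {F : 𝓢'(Rn d, ℂ)} {f : Rn d → ℂ}

theorem distConv_eq_integral (hf : IsContinuousFunction F f) (φ : 𝓢(Rn d, ℂ)) (x : Rn d) :
    distConv F φ x = ∫ z, f z * φ (x - z) := by
  rw [distConv, hf.apply_eq]
  simp

theorem integrable_mul_comp_sub (hf : IsContinuousFunction F f) (φ : 𝓢(Rn d, ℂ)) (x : Rn d) :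
    Integrable fun z => f z * φ (x - z) := by
  simpa using hf.integrable ((SchwartzMap.compCLMOfContinuousLinearEquiv ℂ
    (ContinuousLinearEquiv.neg ℝ) φ).compSubConstCLM ℂ x)

theorem stronglyMeasurable_distConv (hf : IsContinuousFunction F f) (φ : 𝓢(Rn d, ℂ)) :
    StronglyMeasurable (distConv F φ) := by
  have hcont : Continuous fun p : Rn d × Rn d => f p.2 * φ (p.1 - p.2) := by
    have := hf.continuous
    fun_prop
  simpa only [← distConv_eq_integral hf] using
    hcont.stronglyMeasurable.integral_prod_right' (ν := volume)

/-- The convolution of the cut off distribution `χ (c ·) F` with `φ`. As `c → 0` it tends to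
`F * φ`, with at most polynomial growth uniformly in `c`. -/
def cutoffConv (F : 𝓢'(Rn d, ℂ)) (χ φ : 𝓢(Rn d, ℂ)) (c : ℝ) (x : Rn d) : ℂ :=
  F (cutoffTranslate χ
    (SchwartzMap.compCLMOfContinuousLinearEquiv ℂ (ContinuousLinearEquiv.neg ℝ) φ) c x)

theorem cutoffConv_eq_integral (hf : IsContinuousFunction F f) (χ φ : 𝓢(Rn d, ℂ)) (c : ℝ)
    (x : Rn d) : cutoffConv F χ φ c x = ∫ z, f z * (χ (c • z) * φ (x - z)) := by
  simp [cutoffConv, hf.apply_eq, cutoffTranslate_apply]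

theorem stronglyMeasurable_cutoffConv (hf : IsContinuousFunction F f) (χ φ : 𝓢(Rn d, ℂ)) (c : ℝ) :
    StronglyMeasurable (cutoffConv F χ φ c) := by
  have hcont : Continuous fun p : Rn d × Rn d => f p.2 * (χ (c • p.2) * φ (p.1 - p.2)) := by
    have := hf.continuous
    fun_prop
  simpa only [← cutoffConv_eq_integral hf] using
    hcont.stronglyMeasurable.integral_prod_right' (ν := volume)

theorem tendsto_cutoffConv (hf : IsContinuousFunction F f) {χ : 𝓢(Rn d, ℂ)} (hχ : χ 0 = 1)
    (φ : 𝓢(Rn d, ℂ)) (x : Rn d) :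
    Filter.Tendsto (fun c => cutoffConv F χ φ c x) (nhds 0) (nhds (distConv F φ x)) := by
  have hfc := hf.continuous
  simp only [distConv_eq_integral hf, cutoffConv_eq_integral hf]
  refine tendsto_integral_filter_of_dominated_convergence
    (fun z => SchwartzMap.seminorm ℝ 0 0 χ * ‖f z * φ (x - z)‖)
    (.of_forall fun c => (by fun_prop : Continuous _).aestronglyMeasurable)
    (.of_forall fun c => .of_forall fun z => ?_)
    ((integrable_mul_comp_sub hf φ x).norm.const_mul _) (.of_forall fun z => ?_)
  · rw [mul_left_comm, norm_mul]
    exact mul_le_mul_of_nonneg_right (SchwartzMap.norm_le_seminorm ℝ χ _) (norm_nonneg _)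
  · have hcont : Continuous fun c : ℝ => f z * (χ (c • z) * φ (x - z)) := by fun_prop
    simpa [hχ] using hcont.tendsto 0

variable {E : Type*} [NormedAddCommGroup E] [NormedSpace ℝ E] [FiniteDimensional ℝ E]
  [MeasureSpace E] [BorelSpace E] [(volume : Measure E).IsAddHaarMeasure]

theorem integral_cutoffConv_mul (hf : IsContinuousFunction F f) (χ φ : 𝓢(Rn d, ℂ)) (K : 𝓢(E, ℂ))
    (L : E →L[ℝ] Rn d) (hφ : ∀ u, ∫ r, φ (u - L r) * K r = φ u) {c : ℝ} (hc : c ≠ 0) (x : Rn d) :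
    ∫ r, cutoffConv F χ φ c (x - L r) * K r = cutoffConv F χ φ c x := by
  have hfχ : Integrable fun z => f z * χ (c • z) :=
    hf.integrable (SchwartzMap.compCLMOfContinuousLinearEquiv ℂ
      (ContinuousLinearEquiv.smulLeft (Units.mk0 c hc)) χ)
  have hint : Integrable (fun p : E × Rn d => φ (x - L p.1 - p.2) *
      (K p.1 * (f p.2 * χ (c • p.2)))) (volume.prod volume) :=
    (K.integrable.mul_prod hfχ).bdd_mul (by fun_prop : Continuous _).aestronglyMeasurable
      (.of_forall fun p => SchwartzMap.norm_le_seminorm ℝ φ _)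
  simp only [cutoffConv_eq_integral hf]
  calc ∫ r, (∫ z, f z * (χ (c • z) * φ (x - L r - z))) * K r
      = ∫ r, ∫ z, φ (x - L r - z) * (K r * (f z * χ (c • z))) := by
        simp only [← integral_mul_const]
        congr! 4
        ring
    _ = ∫ z, ∫ r, f z * χ (c • z) * (φ (x - z - L r) * K r) := by
        rw [integral_integral_swap hint]
        congr! 4
        rw [sub_right_comm]
        ring
    _ = ∫ z, f z * (χ (c • z) * φ (x - z)) := by
        simp only [integral_const_mul, hφ, mul_assoc]

theorem integral_distConv_mul (hf : IsContinuousFunction F f) (φ : 𝓢(Rn d, ℂ)) (K : 𝓢(E, ℂ))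
    (L : E →L[ℝ] Rn d) (hφ : ∀ u, ∫ r, φ (u - L r) * K r = φ u) (x : Rn d) :
    ∫ r, distConv F φ (x - L r) * K r = distConv F φ x := by
  obtain ⟨χ, hχ⟩ := exists_schwartz_eq_one (Rn d)
  have htendsto (y) : Filter.Tendsto (fun c => cutoffConv F χ φ c y) (nhdsWithin 0 {0}ᶜ)
      (nhds (distConv F φ y)) :=
    (tendsto_cutoffConv hf (hχ 0 (by simp)) φ y).mono_left nhdsWithin_le_nhds
  have hsmall : ∀ᶠ c : ℝ in nhdsWithin 0 {0}ᶜ, |c| ≤ 1 :=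
    nhdsWithin_le_nhds ((continuous_abs.tendsto' 0 0 abs_zero).eventually_le_const one_pos)
  obtain ⟨C, k, hC, hbound⟩ := exists_norm_apply_cutoffTranslate_le F χ
    (SchwartzMap.compCLMOfContinuousLinearEquiv ℂ (ContinuousLinearEquiv.neg ℝ) φ)
  have hlim : Filter.Tendsto (fun c => ∫ r, cutoffConv F χ φ c (x - L r) * K r)
      (nhdsWithin 0 {0}ᶜ) (nhds (∫ r, distConv F φ (x - L r) * K r)) := by
    refine tendsto_integral_filter_of_dominated_convergence
      (fun r => C * ((1 + ‖x‖) * (1 + ‖L‖)) ^ k * ((1 + ‖r‖) ^ k * ‖K r‖))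
      (.of_forall fun c => ?_) (hsmall.mono fun c hc => .of_forall fun r => ?_)
      ((integrable_one_add_norm_pow_mul volume K k).const_mul _)
      (.of_forall fun r => (htendsto _).mul_const _)
    · exact (((stronglyMeasurable_cutoffConv hf χ φ c).comp_measurable
        (by fun_prop)).aestronglyMeasurable).mul K.continuous.aestronglyMeasurable
    · rw [norm_mul, ← mul_assoc, mul_assoc C, ← mul_pow]
      gcongr
      exact (hbound c _ hc).trans (by gcongr; exact one_add_norm_sub_apply_le L x r)
  refine tendsto_nhds_unique (hlim.congr' ?_) (htendsto x)
  filter_upwards [self_mem_nhdsWithin] with c hc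
  exact integral_cutoffConv_mul hf χ φ K L hφ hc x

end DistConv

/-! ### Band-limitedness of the dyadic pieces -/

section DyadicPiece

variable {E V : Type*} [NormedAddCommGroup E] [InnerProductSpace ℝ E] [FiniteDimensional ℝ E]
  [MeasurableSpace E] [BorelSpace E] [NormedAddCommGroup V] [InnerProductSpace ℝ V]
  [FiniteDimensional ℝ V] [MeasurableSpace V] [BorelSpace V]

theorem fourierInv_schwartz_apply (s : 𝓢(V, ℂ)) (u : V) :
    (𝓕⁻ s) u = ∫ ξ, Complex.exp ((2 * Real.pi * inner ℝ ξ u : ℝ) * Complex.I) * s ξ := by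
  rw [SchwartzMap.fourierInv_coe, Real.fourierInv_eq']
  rfl

theorem integral_fourierInv_sub_mul (s : 𝓢(V, ℂ)) (K : 𝓢(E, ℂ)) (L : E →L[ℝ] V)
    (hKs : ∀ ξ, s ξ ≠ 0 → (𝓕 K) (LinearMap.adjoint (L : E →ₗ[ℝ] V) ξ) = 1) (u : V) :
    ∫ r, (𝓕⁻ s) (u - L r) * K r = (𝓕⁻ s) u := by
  have hint : Integrable (fun p : E × V =>
      Complex.exp ((2 * Real.pi * inner ℝ p.2 (u - L p.1) : ℝ) * Complex.I) * (K p.1 * s p.2))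
      (volume.prod volume) :=
    (K.integrable.mul_prod s.integrable).bdd_mul (by fun_prop : Continuous _).aestronglyMeasurable
      (.of_forall fun p => (Complex.norm_exp_ofReal_mul_I _).le)
  have hsplit (ξ : V) (r : E) : 2 * Real.pi * inner ℝ ξ (u - L r) = 2 * Real.pi * inner ℝ ξ u +
      -2 * Real.pi * inner ℝ r (LinearMap.adjoint (L : E →ₗ[ℝ] V) ξ) := by
    rw [inner_sub_right, real_inner_comm _ r, LinearMap.adjoint_inner_left,
      ContinuousLinearMap.coe_coe]
    ring
  have hfourier (η : E) :
      ∫ r, Complex.exp ((-2 * Real.pi * inner ℝ r η : ℝ) * Complex.I) * K r = (𝓕 K) η := by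
    rw [SchwartzMap.fourier_coe, Real.fourier_eq']
    rfl
  calc ∫ r, (𝓕⁻ s) (u - L r) * K r
      = ∫ r, ∫ ξ, Complex.exp ((2 * Real.pi * inner ℝ ξ (u - L r) : ℝ) * Complex.I) *
          (K r * s ξ) := by
        simp only [fourierInv_schwartz_apply, ← integral_mul_const, mul_assoc, mul_comm (K _)]
    _ = ∫ ξ, ∫ r, Complex.exp ((2 * Real.pi * inner ℝ ξ (u - L r) : ℝ) * Complex.I) *
          (K r * s ξ) := integral_integral_swap hint
    _ = ∫ ξ, Complex.exp ((2 * Real.pi * inner ℝ ξ u : ℝ) * Complex.I) * s ξ *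
          (𝓕 K) (LinearMap.adjoint (L : E →ₗ[ℝ] V) ξ) := by
        simp only [← hfourier, ← integral_const_mul, hsplit, Complex.ofReal_add, add_mul,
          Complex.exp_add]
        congr! 4
        ring
    _ = (𝓕⁻ s) u := by
        rw [fourierInv_schwartz_apply]
        congr with ξ
        by_cases hξ : s ξ = 0
        · simp [hξ]
        · rw [hKs ξ hξ, mul_one]

theorem exists_schwartz_fourier_eq_one (E : Type*) [NormedAddCommGroup E] [InnerProductSpace ℝ E]
    [FiniteDimensional ℝ E] [MeasurableSpace E] [BorelSpace E] :
    ∃ K : 𝓢(E, ℂ), ∀ ξ, ‖ξ‖ ≤ 1 → (𝓕 K) ξ = 1 := by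
  obtain ⟨χ, hχ⟩ := exists_schwartz_eq_one E
  exact ⟨𝓕⁻ χ, fun ξ hξ => by rw [FourierTransform.fourier_fourierInv_eq, hχ ξ hξ]⟩

variable {d : ℕ} {w : ℝ → ℝ} (hw : IsDyadicWindow w) {F : 𝓢'(Rn d, ℂ)} {f : Rn d → ℂ}

include hw in
theorem norm_le_of_dyadicSymbol_ne_zero {n : ℤ} {ξ : Rn d} (h : dyadicSymbol d w n ξ ≠ 0) :
    ‖ξ‖ ≤ 2 ^ n := by
  have hne : w (2 * Real.pi * ‖ξ‖ / 2 ^ n) ≠ 0 := fun h0 => h (by simp [dyadicSymbol, h0])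
  have hle := (hw.support_subset hne).2
  rw [div_le_iff₀ (by positivity)] at hle
  nlinarith [Real.pi_gt_three, norm_nonneg ξ]

theorem integral_dyadicPiece_mul (hf : IsContinuousFunction F f) (n : ℤ) {K : 𝓢(E, ℂ)}
    (hK : ∀ ξ, ‖ξ‖ ≤ 1 → (𝓕 K) ξ = 1) (L : E →L[ℝ] Rn d) (hL : ‖L‖ ≤ (2 ^ n)⁻¹) (x : Rn d) :
    ∫ r, dyadicPiece hw F n (x - L r) * K r = dyadicPiece hw F n x := by
  have := FiniteDimensional.complete ℝ E
  refine integral_distConv_mul hf _ K L (integral_fourierInv_sub_mul _ K L fun ξ hξ => hK _ ?_) x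
  calc ‖LinearMap.adjoint (L : E →ₗ[ℝ] Rn d) ξ‖ = ‖ContinuousLinearMap.adjoint L ξ‖ := rfl
    _ ≤ ‖ContinuousLinearMap.adjoint L‖ * ‖ξ‖ := ContinuousLinearMap.le_opNorm _ _
    _ ≤ (2 ^ n)⁻¹ * 2 ^ n := by
      rw [LinearIsometryEquiv.norm_map]
      gcongr
      exact norm_le_of_dyadicSymbol_ne_zero hw hξ
    _ = 1 := inv_mul_cancel₀ (by positivity)

theorem norm_dyadicPiece_le (hf : IsContinuousFunction F f) (n : ℤ) {K : 𝓢(Rn d, ℂ)}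
    (hK : ∀ ξ, ‖ξ‖ ≤ 1 → (𝓕 K) ξ = 1) (hfin : eLpNorm (dyadicPiece hw F n) ⊤ volume ≠ ⊤)
    (x : Rn d) : ‖dyadicPiece hw F n x‖ ≤
      (eLpNorm (dyadicPiece hw F n) ⊤ volume).toReal * ∫ r, ‖K r‖ := by
  have hL : ‖((2 : ℝ) ^ n)⁻¹ • ContinuousLinearMap.id ℝ (Rn d)‖ ≤ (2 ^ n)⁻¹ := by
    rw [norm_smul, Real.norm_of_nonneg (by positivity)]
    exact mul_le_of_le_one_right (by positivity) ContinuousLinearMap.norm_id_le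
  have hae : ∀ᵐ y, ‖dyadicPiece hw F n y‖ ≤ (eLpNorm (dyadicPiece hw F n) ⊤ volume).toReal := by
    filter_upwards [ae_le_eLpNormEssSup (f := dyadicPiece hw F n) (μ := volume)] with y hy
    rw [← eLpNorm_exponent_top] at hy
    simpa using ENNReal.toReal_mono hfin hy
  have hquasi : Measure.QuasiMeasurePreserving (fun r : Rn d => x - ((2 : ℝ) ^ n)⁻¹ • r) :=
    (Measure.measurePreserving_sub_left volume x).quasiMeasurePreserving.comp
      (Measure.quasiMeasurePreserving_smul volume (by positivity))
  rw [← integral_dyadicPiece_mul hw hf n hK _ hL, ← integral_const_mul]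
  refine norm_integral_le_of_norm_le (K.integrable.norm.const_mul _) ?_
  filter_upwards [hquasi.ae hae] with r hr
  rw [norm_mul]
  exact mul_le_mul_of_nonneg_right hr (norm_nonneg _)

theorem isReproduced_dyadicPiece (hf : IsContinuousFunction F f) (n : ℤ) {K : 𝓢(ℝ, ℂ)}
    (hK : ∀ ξ, ‖ξ‖ ≤ 1 → (𝓕 K) ξ = 1) {M : ℝ} (hM : ∀ x, ‖dyadicPiece hw F n x‖ ≤ M)
    {e : Rn d} (he : ‖e‖ ≤ 1) (x : Rn d) :
    IsReproduced K (fun s => dyadicPiece hw F n (x + (s / 2 ^ n) • e)) M where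
  measurable := (stronglyMeasurable_distConv hf _).measurable.comp (by fun_prop)
  bound s := hM _
  integral_eq θ hθ c s := by
    have hL : ‖(ContinuousLinearMap.id ℝ ℝ).smulRight ((θ / 2 ^ n) • e)‖ ≤ (2 ^ n)⁻¹ := by
      rw [ContinuousLinearMap.norm_smulRight_apply, ContinuousLinearMap.norm_id, one_mul, norm_smul,
        norm_div, Real.norm_of_nonneg hθ.1, Real.norm_of_nonneg (by positivity), div_eq_mul_inv,
        mul_right_comm]
      exact mul_le_of_le_one_left (by positivity) (mul_le_one₀ hθ.2 (norm_nonneg e) he)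
    rw [← integral_dyadicPiece_mul hw hf n hK _ hL]
    congr! 4 with r
    simp only [ContinuousLinearMap.smulRight_apply, ContinuousLinearMap.id_apply, smul_smul,
      add_sub_assoc, ← sub_smul]
    ring_nf

theorem exists_hasDividedFactor_dyadicPiece :
    ∃ C : ℝ, 0 ≤ C ∧ ∀ (F : 𝓢'(Rn d, ℂ)) (f : Rn d → ℂ), IsContinuousFunction F f → ∀ n : ℤ,
      eLpNorm (dyadicPiece hw F n) ⊤ volume ≠ ⊤ → ∀ (e : Rn d) (b : ℝ → Rn d), ‖e‖ ≤ 1 →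
      HasDividedFactor (fun s y => dyadicPiece hw F n (b y + s • e))
        (C * (2 ^ n * (eLpNorm (dyadicPiece hw F n) ⊤ volume).toReal)) := by
  obtain ⟨K, hK⟩ := exists_schwartz_fourier_eq_one ℝ
  obtain ⟨V, hV⟩ := exists_schwartz_fourier_eq_one (Rn d)
  obtain ⟨C, hC, hfactor⟩ := exists_hasDividedFactor_of_isReproduced K
  refine ⟨C * ∫ r, ‖V r‖, by positivity, fun F f hf n hfin e b he => ?_⟩
  have hscaled := (hfactor _ _ fun y => isReproduced_dyadicPiece hw hf n hK
    (norm_dyadicPiece_le hw hf n hV hfin) he (b y)).comp_mul_left (2 ^ n)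
  simp only [mul_div_cancel_left₀ _ (zpow_ne_zero n (two_ne_zero' ℝ))] at hscaled
  convert hscaled using 1
  ring

end DyadicPiece

/-! ### The Littlewood--Paley expansion up to constants -/

section Lipschitz

variable {τ V : Type*} [NormedAddCommGroup V] {m : τ → ℝ≥0} {u : τ → V → ℂ}

theorem summable_sub_of_lipschitzWith (hm : Summable m) (hu : ∀ n, LipschitzWith (m n) (u n))
    (x y : V) : Summable fun n => u n x - u n y :=
  .of_norm_bounded ((NNReal.summable_coe.2 hm).mul_right ‖x - y‖) fun n => (hu n).norm_sub_le x y

theorem hasSum_sub_of_lipschitzWith (hm : Summable m) (hu : ∀ n, LipschitzWith (m n) (u n))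
    (x y z : V) : HasSum (fun n => u n x - u n y)
      (∑' n, (u n x - u n z) - ∑' n, (u n y - u n z)) := by
  simpa only [sub_sub_sub_cancel_right] using (summable_sub_of_lipschitzWith hm hu x z).hasSum.sub
    (summable_sub_of_lipschitzWith hm hu y z).hasSum

theorem lipschitzWith_tsum_sub (hm : Summable m) (hu : ∀ n, LipschitzWith (m n) (u n)) (z : V) :
    LipschitzWith (∑' n, m n) fun x => ∑' n, (u n x - u n z) := by
  refine .of_dist_le_mul fun x y => ?_
  rw [dist_eq_norm, ← (hasSum_sub_of_lipschitzWith hm hu x y z).tsum_eq, NNReal.coe_tsum,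
    ← tsum_mul_right]
  exact tsum_of_norm_bounded ((NNReal.summable_coe.2 hm).mul_right _).hasSum
    fun n => (hu n).norm_sub_le x y |>.trans_eq (by rw [dist_eq_norm])

variable [NormedSpace ℝ V] [MeasurableSpace V] [BorelSpace V] [SecondCountableTopology V]
  {μ : Measure V} [μ.HasTemperateGrowth]

theorem integrable_mul_schwartz_of_lipschitzWith {g : V → ℂ} {k : ℝ≥0} (hg : LipschitzWith k g)
    (ψ : 𝓢(V, ℂ)) : Integrable (fun x => g x * ψ x) μ := by
  refine ((((ψ.integrable_pow_mul μ 1).const_mul (k : ℝ))).add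
    (ψ.integrable.norm.const_mul ‖g 0‖)).mono'
    (hg.continuous.mul ψ.continuous).aestronglyMeasurable (.of_forall fun x => ?_)
  rw [norm_mul, Pi.add_apply, pow_one, ← mul_assoc, ← add_mul]
  gcongr
  have hle := hg.norm_sub_le x 0
  rw [sub_zero] at hle
  linarith [norm_le_norm_sub_add (g x) (g 0)]

theorem hasSum_integral_mul_schwartz_of_lipschitzWith [Countable τ] (hm : Summable m)
    (hu : ∀ n, LipschitzWith (m n) (u n)) {ψ : 𝓢(V, ℂ)} (hψ : ∫ x, ψ x ∂μ = 0) :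
    HasSum (fun n => ∫ x, u n x * ψ x ∂μ) (∫ x, (∑' n, (u n x - u n 0)) * ψ x ∂μ) := by
  have hm' := NNReal.summable_coe.2 hm
  have hcenter (n : τ) : ∫ x, (u n x - u n 0) * ψ x ∂μ = ∫ x, u n x * ψ x ∂μ := by
    simp only [sub_mul]
    rw [integral_sub (integrable_mul_schwartz_of_lipschitzWith (hu n) ψ)
      (ψ.integrable.const_mul _), integral_const_mul, hψ, mul_zero, sub_zero]
  simp only [← hcenter]
  refine hasSum_integral_of_dominated_convergence (fun n x => m n * (‖x‖ * ‖ψ x‖))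
    (fun n => (((hu n).continuous.sub continuous_const).mul ψ.continuous).aestronglyMeasurable)
    (fun n => .of_forall fun x => ?_) (.of_forall fun x => hm'.mul_right _) ?_
    (.of_forall fun x => (summable_sub_of_lipschitzWith hm hu x 0).hasSum.mul_right _)
  · rw [norm_mul, ← mul_assoc]
    gcongr
    simpa using (hu n).norm_sub_le x 0
  · simp only [tsum_mul_right]
    simpa using (ψ.integrable_pow_mul μ 1).const_mul (∑' n, (m n : ℝ))

end Lipschitz

section Gradient

theorem exists_schwartz_lineDerivOp_eq {V : Type*} [NormedAddCommGroup V]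
    [NormedSpace ℝ V] {ρ : V → ℝ} (hρc : HasCompactSupport ρ) (hρ : ContDiff ℝ ∞ ρ)
    (z : V) : ∃ φ : 𝓢(V, ℂ), ∀ v x, (∂_{v} φ) x = -(fderiv ℝ ρ (z - x) v : ℂ) := by
  have hφc : HasCompactSupport fun x => (ρ (z - x) : ℂ) :=
    (hρc.comp_homeomorph (Homeomorph.subLeft z)).comp_left (g := Complex.ofReal)
      Complex.ofReal_zero
  have hφ : ContDiff ℝ ∞ fun x => (ρ (z - x) : ℂ) :=
    Complex.ofRealCLM.contDiff.comp (hρ.comp (contDiff_const.sub contDiff_id))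
  refine ⟨hφc.toSchwartzMap hφ, fun v x => ?_⟩
  have hderiv : HasFDerivAt (hφc.toSchwartzMap hφ : V → ℂ)
      (Complex.ofRealCLM.comp ((fderiv ℝ ρ (z - x)).comp (-ContinuousLinearMap.id ℝ V))) x :=
    Complex.ofRealCLM.hasFDerivAt.comp x <|
      ((hρ.differentiable (by simp)).differentiableAt.hasFDerivAt).comp x
        ((hasFDerivAt_id x).const_sub z)
  rw [SchwartzMap.lineDerivOp_apply_eq_fderiv, hderiv.fderiv]
  simp

variable {V : Type*} [NormedAddCommGroup V] [NormedSpace ℝ V] [FiniteDimensional ℝ V]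
  [MeasureSpace V] [BorelSpace V] [(volume : Measure V).IsAddHaarMeasure]

theorem integral_lineDerivOp_eq_zero (φ : 𝓢(V, ℂ)) (v : V) : ∫ x, (∂_{v} φ) x = 0 := by
  have hφ' : Integrable fun x => (∂_{v} φ : 𝓢(V, ℂ)) x := (∂_{v} φ : 𝓢(V, ℂ)).integrable
  have h := integral_bilinear_hasLineDerivAt_right_eq_neg_left_of_integrable (μ := volume)
    (f := fun _ : V => (1 : ℂ)) (f' := fun _ => 0) (g := φ)
    (g' := fun x => (∂_{v} φ : 𝓢(V, ℂ)) x) (v := v)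
    (B := ContinuousLinearMap.mul ℝ ℂ) (by simp) (by simpa using hφ')
    (by simpa using φ.integrable)
    (fun x _ => by simpa using (hasFDerivAt_const (𝕜 := ℝ) (1 : ℂ) x).hasLineDerivAt v)
    (fun x _ => by
      rw [SchwartzMap.lineDerivOp_apply_eq_fderiv]
      exact (φ.hasFDerivAt x).hasLineDerivAt v)
  simpa using h

open scoped Convolution in
theorem convolution_eq_of_integral_mul_lineDerivOp_eq_zero {ι : Type*} (b : Module.Basis ι ℝ V)
    {h : V → ℂ} (hc : Continuous h) (hderiv : ∀ j (φ : 𝓢(V, ℂ)), ∫ x, h x * (∂_{b j} φ) x = 0)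
    {ρ : V → ℝ} (hρc : HasCompactSupport ρ) (hρ : ContDiff ℝ ∞ ρ) (x y : V) :
    (ρ ⋆[ContinuousLinearMap.lsmul ℝ ℝ, volume] h) x =
      (ρ ⋆[ContinuousLinearMap.lsmul ℝ ℝ, volume] h) y := by
  have hconv := hρc.hasFDerivAt_convolution_left (ContinuousLinearMap.lsmul ℝ ℝ)
    (hρ.of_le (by exact_mod_cast le_top)) hc.locallyIntegrable (μ := volume)
  refine is_const_of_fderiv_eq_zero (𝕜 := ℝ) (fun z => (hconv z).differentiableAt)
    (fun z => ContinuousLinearMap.coe_injective (b.ext fun j => ?_)) x y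
  have hexists : ConvolutionExistsAt (fderiv ℝ ρ) h z
      ((ContinuousLinearMap.lsmul ℝ ℝ).precompL V) volume :=
    (hρc.fderiv ℝ).convolutionExists_left _ (hρ.continuous_fderiv (by simp)) hc.locallyIntegrable z
  obtain ⟨φ, hφ⟩ := exists_schwartz_lineDerivOp_eq hρc hρ z
  calc fderiv ℝ (ρ ⋆[ContinuousLinearMap.lsmul ℝ ℝ, volume] h) z (b j)
      = ∫ x, fderiv ℝ ρ x (b j) • h (z - x) := by
        rw [(hconv z).fderiv, convolution_def, ContinuousLinearMap.integral_apply hexists]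
        rfl
    _ = ∫ x, fderiv ℝ ρ (z - x) (b j) • h x := by
        rw [← integral_sub_left_eq_self _ volume z]
        simp only [sub_sub_cancel]
    _ = -∫ x, h x * (∂_{b j} φ) x := by
        simp only [hφ, mul_neg, integral_neg, neg_neg, Complex.real_smul, mul_comm]
    _ = 0 := by rw [hderiv, neg_zero]

theorem eq_of_integral_mul_lineDerivOp_eq_zero {ι : Type*} (b : Module.Basis ι ℝ V) {h : V → ℂ}
    (hc : Continuous h) (hderiv : ∀ j (φ : 𝓢(V, ℂ)), ∫ x, h x * (∂_{b j} φ) x = 0) (x y : V) :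
    h x = h y := by
  let ρ (n : ℕ) : ContDiffBump (0 : V) :=
    ⟨1 / ((n : ℝ) + 1), 2 * (1 / ((n : ℝ) + 1)), by positivity, by
      linarith [show 0 < 1 / ((n : ℝ) + 1) by positivity]⟩
  have hρ : Filter.Tendsto (fun n => (ρ n).rOut) Filter.atTop (nhds 0) := by
    simpa [ρ] using (tendsto_one_div_add_atTop_nhds_zero_nat (𝕜 := ℝ)).const_mul 2
  have hlim := ContDiffBump.convolution_tendsto_right_of_continuous (μ := volume) hρ hc
  exact tendsto_nhds_unique (hlim x) <| (hlim y).congr fun n =>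
    convolution_eq_of_integral_mul_lineDerivOp_eq_zero b hc hderiv (ρ n).hasCompactSupport_normed
      (ρ n).contDiff_normed y x

end Gradient

section LittlewoodPaley

variable {d : ℕ} {w : ℝ → ℝ} {hw : IsDyadicWindow w} {F : 𝓢'(Rn d, ℂ)} {f : Rn d → ℂ}

theorem eLpNorm_dyadicPiece_ne_top (hF : besovNorm hw F ≠ ⊤) (n : ℤ) :
    eLpNorm (dyadicPiece hw F n) ⊤ volume ≠ ⊤ := fun h => by
  refine ENNReal.ne_top_of_tsum_ne_top hF n ?_
  rw [h, ENNReal.mul_top (ENNReal.zpow_pos two_ne_zero (by simp) n).ne']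

theorem hasSum_besovNorm_toReal (hF : besovNorm hw F ≠ ⊤) :
    HasSum (fun n : ℤ => (2 : ℝ) ^ n * (eLpNorm (dyadicPiece hw F n) ⊤ volume).toReal)
      (besovNorm hw F).toReal := by
  have hzpow (n : ℤ) : ((2 : ℝ≥0∞) ^ n).toReal = (2 : ℝ) ^ n := by
    rw [← ENNReal.rpow_intCast, ← ENNReal.toReal_rpow, Real.rpow_intCast]
    simp
  rw [besovNorm, ENNReal.tsum_toReal_eq fun n => ENNReal.ne_top_of_tsum_ne_top hF n]
  simpa [ENNReal.toReal_mul, hzpow] using ENNReal.hasSum_toReal hF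

variable (hw) in
theorem exists_lipschitzWith_dyadicPiece :
    ∃ C : ℝ, ∀ (F : 𝓢'(Rn d, ℂ)) (f : Rn d → ℂ), IsContinuousFunction F f → ∀ n : ℤ,
      eLpNorm (dyadicPiece hw F n) ⊤ volume ≠ ⊤ →
      LipschitzWith (C * (2 ^ n * (eLpNorm (dyadicPiece hw F n) ⊤ volume).toReal)).toNNReal
        (dyadicPiece hw F n) := by
  obtain ⟨C, hC, hfactor⟩ := exists_hasDividedFactor_dyadicPiece (d := d) hw
  refine ⟨C, fun F f hf n hfin => .of_dist_le' fun x y => ?_⟩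
  have hunit : ‖x - y‖ • ‖x - y‖⁻¹ • (x - y) = x - y := by
    obtain h | h := eq_or_ne (x - y) 0
    · simp [h]
    · exact smul_inv_smul₀ (norm_ne_zero_iff.2 h) _
  have hle := (hfactor F f hf n hfin (‖x - y‖⁻¹ • (x - y)) (fun _ => y)
    (by simpa [norm_smul] using inv_mul_le_one)).norm_sub_le (by positivity) ‖x - y‖ 0 0
  simpa [hunit, dist_eq_norm] using hle

theorem hasSum_dyadicPiece_sub (hF : MemBesov hw F) (hf : IsContinuousFunction F f) (x y : Rn d) :
    HasSum (fun n : ℤ => dyadicPiece hw F n x - dyadicPiece hw F n y) (f x - f y) := by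
  obtain ⟨C, hlip⟩ := exists_lipschitzWith_dyadicPiece (d := d) hw
  have hu (n : ℤ) := hlip F f hf n (eLpNorm_dyadicPiece_ne_top hF.norm_ne_top n)
  have hm := ((hasSum_besovNorm_toReal hF.norm_ne_top).summable.mul_left C).toNNReal
  set g : Rn d → ℂ := fun x => ∑' n : ℤ, (dyadicPiece hw F n x - dyadicPiece hw F n 0)
  have hg : LipschitzWith _ g := lipschitzWith_tsum_sub hm hu 0
  have hgrad (j : Fin d) (φ : 𝓢(Rn d, ℂ)) :
      ∫ x, (f x - g x) * (∂_{(EuclideanSpace.basisFun (Fin d) ℝ).toBasis j} φ) x = 0 := by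
    rw [OrthonormalBasis.coe_toBasis, EuclideanSpace.basisFun_apply]
    set ψ : 𝓢(Rn d, ℂ) := ∂_{(EuclideanSpace.single j 1 : Rn d)} φ
    have hderiv := (hasSum_integral_mul_schwartz_of_lipschitzWith hm hu
      (integral_lineDerivOp_eq_zero φ (EuclideanSpace.single j 1))).neg.unique
      (hF.hasSum_deriv j φ)
    rw [TemperedDistribution.lineDerivOp_apply_apply, map_neg, hf.apply_eq, neg_inj] at hderiv
    simp only [sub_mul]
    rw [integral_sub (hf.integrable ψ) (integrable_mul_schwartz_of_lipschitzWith hg ψ), hderiv,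
      sub_self]
  have hconst : f x - g x = f y - g y :=
    eq_of_integral_mul_lineDerivOp_eq_zero _ (hf.continuous.sub hg.continuous) hgrad x y
  rw [show f x - f y = g x - g y by linear_combination hconst]
  exact hasSum_sub_of_lipschitzWith hm hu x y 0

end LittlewoodPaley

section UpperBound

theorem exists_schattenNorm_pairFunction_sub_le {w : ℝ → ℝ} (hw : IsDyadicWindow w) :
    ∃ C : ℝ≥0, ∀ (p : ℝ≥0∞) (_ : 2 ≤ p) (N : ℕ)
      (H : Type*) [NormedAddCommGroup H] [InnerProductSpace ℂ H] [CompleteSpace H]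
      (A₁ B₁ A₂ B₂ : H →L[ℂ] H)
      (_ : IsSelfAdjoint A₁) (_ : IsSelfAdjoint B₁) (_ : IsSelfAdjoint A₂) (_ : IsSelfAdjoint B₂)
      (_ : RankLE A₁ N) (_ : RankLE B₁ N) (_ : RankLE A₂ N) (_ : RankLE B₂ N)
      (F : 𝓢'(Rn 2, ℂ)) (f : Rn 2 → ℂ) (_ : MemBesov hw F) (_ : IsContinuousFunction F f),
      schattenNorm p (pairFunction f A₁ B₁ - pairFunction f A₂ B₂) ≤
        C * (N : ℝ≥0∞) ^ ((1 : ℝ) / 2 - 1 / p.toReal) * besovNorm hw F *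
          max (schattenNorm p (A₁ - A₂)) (schattenNorm p (B₁ - B₂)) := by
  obtain ⟨C, hC, hfactor⟩ := exists_hasDividedFactor_dyadicPiece (d := 2) hw
  refine ⟨4 * C.toNNReal, fun p hp N H _ _ _ A₁ B₁ A₂ B₂ hA₁ hB₁ hA₂ hB₂ hA₁N hB₁N hA₂N hB₂N F f
    hF hf => ?_⟩
  have hnorm := (hasSum_besovNorm_toReal hF.norm_ne_top).mul_left C
  have hvec (x y : ℝ) : (!₂[x, y] : Rn 2) = !₂[0, y] + x • EuclideanSpace.single 0 1 ∧
      (!₂[x, y] : Rn 2) = !₂[x, 0] + y • EuclideanSpace.single 1 1 := by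
    constructor <;> ext i <;> fin_cases i <;> simp
  have hpiece (n : ℤ) := hfactor F f hf n (eLpNorm_dyadicPiece_ne_top hF.norm_ne_top n)
  have hpiece₀ (n : ℤ) : HasDividedFactor (fun x y => dyadicPiece hw F n !₂[x, y])
      (C * (2 ^ n * (eLpNorm (dyadicPiece hw F n) ⊤ volume).toReal)) := by
    simpa only [← (hvec _ _).1] using
      hpiece n (EuclideanSpace.single 0 1) (fun y => !₂[0, y]) (by simp)
  have hpiece₁ (n : ℤ) : HasDividedFactor (fun y x => dyadicPiece hw F n !₂[x, y])
      (C * (2 ^ n * (eLpNorm (dyadicPiece hw F n) ⊤ volume).toReal)) := by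
    simpa only [← (hvec _ _).2] using
      hpiece n (EuclideanSpace.single 1 1) (fun x => !₂[x, 0]) (by simp)
  have hle := schattenNorm_pairFunction_sub_le (fn := dyadicPiece hw F) (fun n => by positivity)
    hnorm.summable hpiece₀ hpiece₁ (hasSum_dyadicPiece_sub hF hf) hp hA₁ hB₁ hA₂ hB₂
    hA₁N hB₁N hA₂N hB₂N
  rw [hnorm.tsum_eq, ENNReal.ofReal_mul hC, ENNReal.ofReal_toReal hF.norm_ne_top] at hle
  refine hle.trans_eq ?_
  rw [ENNReal.ofReal, ENNReal.coe_mul, ENNReal.coe_ofNat]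
  ring

end UpperBound

/-! ### Superpositions of translates of `W_0` -/

section Translates

variable {d : ℕ} {w : ℝ → ℝ}

theorem IsDyadicWindow.support_subset_Ioo (hw : IsDyadicWindow w) :
    Function.support w ⊆ Set.Ioo (1 / 2) 2 := by
  rw [← interior_Icc]
  exact hw.smooth.continuous.isOpen_support.subset_interior_iff.2 hw.support_subset

theorem IsDyadicWindow.eq_zero_of_le (hw : IsDyadicWindow w) {s : ℝ} (hs : s ≤ 1 / 2) :
    w s = 0 :=
  by_contra fun h => (hw.support_subset_Ioo h).1.not_ge hs

theorem IsDyadicWindow.eq_zero_of_ge (hw : IsDyadicWindow w) {s : ℝ} (hs : 2 ≤ s) : w s = 0 :=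
  by_contra fun h => (hw.support_subset_Ioo h).2.not_ge hs

theorem IsDyadicWindow.sum_eq_one (hw : IsDyadicWindow w) {s : ℝ} (hs : w s ≠ 0) :
    w (s * 2) + (w s + w (s / 2)) = 1 := by
  obtain ⟨hs₁, hs₂⟩ := hw.support_subset hs
  rcases le_total s 1 with h | h
  · have hpart := hw.partition (s * 2) ⟨by linarith, by linarith⟩
    rw [mul_div_cancel_right₀ s two_ne_zero] at hpart
    rw [hw.eq_zero_of_le (show s / 2 ≤ 1 / 2 by linarith)]
    linarith
  · have hpart := hw.partition s ⟨h, hs₂⟩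
    rw [hw.eq_zero_of_ge (show 2 ≤ s * 2 by linarith)]
    linarith

theorem IsDyadicWindow.apply_one (hw : IsDyadicWindow w) : w 1 = 1 := by
  rw [hw.partition 1 ⟨le_rfl, one_le_two⟩, hw.eq_zero_of_le le_rfl, sub_zero]

theorem IsDyadicWindow.mul_eq_zero (hw : IsDyadicWindow w) {n : ℤ}
    (hn : n ∉ ({-1, 0, 1} : Finset ℤ)) (s : ℝ) : w s * w (s / 2 ^ n) = 0 := by
  by_cases hs : w s = 0
  · rw [hs, zero_mul]
  obtain ⟨hs₁, hs₂⟩ := hw.support_subset hs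
  have hpow : (0 : ℝ) < 2 ^ n := by positivity
  have hn' : n ≤ -2 ∨ 2 ≤ n := by
    simp only [Finset.mem_insert, Finset.mem_singleton] at hn
    omega
  rcases hn' with hn' | hn'
  · have hle : (2 : ℝ) ^ n ≤ 1 / 4 := by
      simpa using (zpow_le_zpow_right₀ one_le_two hn').trans_eq (b := (2 : ℝ) ^ (-2 : ℤ))
        (by norm_num : _ = (1 / 4 : ℝ))
    rw [hw.eq_zero_of_ge (s := s / 2 ^ n), mul_zero]
    rw [le_div_iff₀ hpow]
    linarith
  · have hle : (4 : ℝ) ≤ 2 ^ n :=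
      (by norm_num : (4 : ℝ) = 2 ^ (2 : ℤ)).trans_le (zpow_le_zpow_right₀ one_le_two hn')
    rw [hw.eq_zero_of_le (s := s / 2 ^ n), mul_zero]
    rw [div_le_iff₀ hpow]
    linarith

theorem fourier_dyadicKernel (hw : IsDyadicWindow w) (n : ℤ) (ξ : Rn d) :
    𝓕 (dyadicKernel d hw n) ξ = dyadicSymbol d w n ξ := by
  rw [dyadicKernel, FourierTransform.fourier_fourierInv_eq]
  rfl

/-- The Littlewood--Paley piece `g * W_n` of a Schwartz function `g`. -/
def schwartzPiece (hw : IsDyadicWindow w) (g : 𝓢(Rn d, ℂ)) (n : ℤ) : 𝓢(Rn d, ℂ) :=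
  SchwartzMap.convolution (ContinuousLinearMap.mul ℂ ℂ) g (dyadicKernel d hw n)

theorem fourier_schwartzPiece (hw : IsDyadicWindow w) (g : 𝓢(Rn d, ℂ)) (n : ℤ) (ξ : Rn d) :
    𝓕 (schwartzPiece hw g n) ξ = 𝓕 g ξ * dyadicSymbol d w n ξ := by
  rw [schwartzPiece, SchwartzMap.fourier_convolution, SchwartzMap.pairing_apply_apply,
    fourier_dyadicKernel, ContinuousLinearMap.mul_apply']

theorem schwartzPiece_dyadicKernel_zero_eq_zero (hw : IsDyadicWindow w) {n : ℤ}
    (hn : n ∉ ({-1, 0, 1} : Finset ℤ)) : schwartzPiece hw (dyadicKernel d hw 0) n = 0 := by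
  refine (FourierTransform.fourierEquiv ℂ 𝓢(Rn d, ℂ)).map_eq_zero_iff.1 ?_
  ext ξ
  rw [FourierTransform.fourierEquiv_apply, fourier_schwartzPiece, fourier_dyadicKernel]
  simpa [dyadicSymbol] using hw.mul_eq_zero hn (2 * Real.pi * ‖ξ‖)

theorem sum_schwartzPiece_dyadicKernel_zero (hw : IsDyadicWindow w) :
    ∑ n ∈ {-1, 0, 1}, schwartzPiece hw (dyadicKernel d hw 0) n = dyadicKernel d hw 0 := by
  refine (FourierTransform.fourierEquiv ℂ 𝓢(Rn d, ℂ)).injective ?_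
  ext ξ
  simp only [map_sum, sum_apply, FourierTransform.fourierEquiv_apply, fourier_schwartzPiece,
    fourier_dyadicKernel, ← Finset.mul_sum]
  by_cases hξ : w (2 * Real.pi * ‖ξ‖) = 0
  · simp [dyadicSymbol, hξ]
  have hsum : ∑ n ∈ {-1, 0, 1}, dyadicSymbol d w n ξ = 1 := by
    rw [Finset.sum_insert (by decide), Finset.sum_insert (by decide), Finset.sum_singleton]
    simp only [dyadicSymbol, zpow_zero, div_one, zpow_one, zpow_neg, div_inv_eq_mul]
    exact_mod_cast hw.sum_eq_one hξ
  rw [hsum, mul_one]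

theorem dyadicKernel_zero_ne_zero (hw : IsDyadicWindow w) :
    dyadicKernel (d + 1) hw 0 ≠ 0 := fun h => by
  have hfourier := fourier_dyadicKernel (d := d + 1) hw 0
    (EuclideanSpace.single 0 (1 / (2 * Real.pi)))
  have hnorm : 2 * Real.pi * ‖(EuclideanSpace.single 0 (1 / (2 * Real.pi)) : Rn (d + 1))‖ /
      2 ^ (0 : ℤ) = 1 := by
    rw [PiLp.norm_single, Real.norm_of_nonneg (by positivity)]
    field_simp
  rw [h, dyadicSymbol, hnorm, hw.apply_one, ← FourierTransform.fourierEquiv_apply (R := ℂ),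
    map_zero] at hfourier
  simp at hfourier

theorem isContinuousFunction_schwartz (g : 𝓢(Rn d, ℂ)) :
    IsContinuousFunction (g : 𝓢'(Rn d, ℂ)) g where
  continuous := g.continuous
  integrable φ := (SchwartzMap.pairing (ContinuousLinearMap.mul ℂ ℂ) g φ).integrable
  apply_eq φ := by simp only [SchwartzMap.coe_apply, smul_eq_mul, mul_comm]

theorem dyadicPiece_schwartz (hw : IsDyadicWindow w) (g : 𝓢(Rn d, ℂ)) (n : ℤ) :
    dyadicPiece hw g n = schwartzPiece hw g n := by
  ext x
  rw [dyadicPiece, distConv_eq_integral (isContinuousFunction_schwartz g), schwartzPiece,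
    SchwartzMap.convolution_apply]
  rfl

theorem memBesov_schwartz (hw : IsDyadicWindow w) {g : 𝓢(Rn d, ℂ)} {s : Finset ℤ}
    (hzero : ∀ n ∉ s, schwartzPiece hw g n = 0) (hsum : ∑ n ∈ s, schwartzPiece hw g n = g) :
    MemBesov hw (g : 𝓢'(Rn d, ℂ)) where
  norm_ne_top := by
    simp only [besovNorm, dyadicPiece_schwartz]
    rw [tsum_eq_sum (s := s) fun n hn => by simp [hzero n hn]]
    refine ENNReal.sum_ne_top.2 fun n _ => ENNReal.mul_ne_top ?_ ?_
    · exact ENNReal.zpow_ne_top two_ne_zero ENNReal.ofNat_ne_top n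
    · exact ((schwartzPiece hw g n).memLp_top volume).eLpNorm_ne_top
  hasSum_deriv j φ := by
    rw [TemperedDistribution.lineDerivOp_apply_apply, map_neg]
    set χ : 𝓢(Rn d, ℂ) := ∂_{(EuclideanSpace.single j 1 : Rn d)} φ
    have hg : (g : 𝓢'(Rn d, ℂ)) χ = ∑ n ∈ s, ∫ x, schwartzPiece hw g n x * χ x := by
      rw [← integral_finsetSum _ fun n _ => (isContinuousFunction_schwartz _).integrable χ,
        (isContinuousFunction_schwartz g).apply_eq]
      simp only [← Finset.sum_mul, ← sum_apply, hsum]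
    rw [hg, ← Finset.sum_neg_distrib]
    simp only [dyadicPiece_schwartz]
    exact hasSum_sum_of_ne_finset_zero fun n hn => by simp [hzero n hn]

theorem besovNorm_schwartz_le (hw : IsDyadicWindow w) {g : 𝓢(Rn d, ℂ)} {M : ℝ}
    (hzero : ∀ n ∉ ({-1, 0, 1} : Finset ℤ), schwartzPiece hw g n = 0)
    (hM : ∀ n ∈ ({-1, 0, 1} : Finset ℤ), ∀ x, ‖schwartzPiece hw g n x‖ ≤ M) :
    besovNorm hw (g : 𝓢'(Rn d, ℂ)) ≤ ENNReal.ofReal (7 / 2 * M) := by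
  have hweights : ∑ n ∈ ({-1, 0, 1} : Finset ℤ), (2 : ℝ≥0∞) ^ n = ENNReal.ofReal (7 / 2) := by
    rw [Finset.sum_insert (by decide), Finset.sum_insert (by decide), Finset.sum_singleton,
      zpow_zero, zpow_one, ENNReal.zpow_neg, zpow_one, ← ENNReal.ofReal_ofNat 2,
      ← ENNReal.ofReal_inv_of_pos two_pos, ← ENNReal.ofReal_one,
      ← ENNReal.ofReal_add one_pos.le two_pos.le, ← ENNReal.ofReal_add (by norm_num) (by norm_num)]
    norm_num
  simp only [besovNorm, dyadicPiece_schwartz]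
  rw [tsum_eq_sum (s := {-1, 0, 1}) fun n hn => by simp [hzero n hn],
    ENNReal.ofReal_mul (by norm_num), ← hweights, Finset.sum_mul]
  gcongr with n hn
  exact eLpNormEssSup_le_of_ae_bound (ae_of_all _ (hM n hn))

/-- The superposition `x ↦ ∑ q, c q * ψ (x - v q)` of translates of `ψ`. -/
def translateSum {ι : Type*} [Fintype ι] (c : ι → ℂ) (v : ι → Rn d) (ψ : 𝓢(Rn d, ℂ)) :
    𝓢(Rn d, ℂ) :=
  ∑ q, c q • ψ.compSubConstCLM ℂ (v q)

variable {ι : Type*} [Fintype ι] (c : ι → ℂ) (v : ι → Rn d)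

theorem translateSum_apply (ψ : 𝓢(Rn d, ℂ)) (x : Rn d) :
    translateSum c v ψ x = ∑ q, c q * ψ (x - v q) := by
  simp [translateSum]

theorem schwartzPiece_translateSum (hw : IsDyadicWindow w) (ψ : 𝓢(Rn d, ℂ)) (n : ℤ) :
    schwartzPiece hw (translateSum c v ψ) n = translateSum c v (schwartzPiece hw ψ n) := by
  have htranslate (q : ι) : schwartzPiece hw (ψ.compSubConstCLM ℂ (v q)) n =
      (schwartzPiece hw ψ n).compSubConstCLM ℂ (v q) := by
    ext x
    rw [SchwartzMap.compSubConstCLM_apply, schwartzPiece, schwartzPiece,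
      SchwartzMap.convolution_apply, SchwartzMap.convolution_apply, convolution_def,
      convolution_def, ← integral_add_right_eq_self _ (v q)]
    simp [sub_add_eq_sub_sub_swap]
  simp only [translateSum, ← htranslate]
  simp [schwartzPiece]

theorem schwartzPiece_translateSum_eq_zero (hw : IsDyadicWindow w) {n : ℤ}
    (hn : n ∉ ({-1, 0, 1} : Finset ℤ)) :
    schwartzPiece hw (translateSum c v (dyadicKernel d hw 0)) n = 0 := by
  rw [schwartzPiece_translateSum, schwartzPiece_dyadicKernel_zero_eq_zero hw hn]
  simp [translateSum]

theorem memBesov_translateSum (hw : IsDyadicWindow w) :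
    MemBesov hw (translateSum c v (dyadicKernel d hw 0) : 𝓢'(Rn d, ℂ)) := by
  refine memBesov_schwartz hw (s := {-1, 0, 1})
    (fun n hn => schwartzPiece_translateSum_eq_zero c v hw hn) ?_
  simp only [schwartzPiece_translateSum]
  simp only [translateSum]
  rw [Finset.sum_comm]
  simp only [← Finset.smul_sum, ← map_sum, sum_schwartzPiece_dyadicKernel_zero]

end Translates

section Interpolation

section Separated

variable {ι V : Type*} [Fintype ι] [NormedAddCommGroup V] {v : ι → V} {ℓ : ℝ}

theorem norm_sum_translates_sub_le (hv : Pairwise fun q q' => ℓ ≤ ‖v q - v q'‖) {c : ι → ℂ}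
    {κ η : ℝ} (hc : ∀ q, ‖c q‖ ≤ κ) {g : V → ℂ} (hη : 0 ≤ η)
    (hg : ∀ u, ℓ / 2 ≤ ‖u‖ → ‖g u‖ ≤ η) {x : V} {q₀ : ι} (hx : ‖x - v q₀‖ ≤ ℓ / 2) :
    ‖∑ q, c q * g (x - v q) - c q₀ * g (x - v q₀)‖ ≤ κ * (Fintype.card ι * η) := by
  classical
  have hκ : 0 ≤ κ := (norm_nonneg _).trans (hc q₀)
  rw [← Finset.sum_erase_eq_sub (Finset.mem_univ q₀)]
  calc ‖∑ q ∈ Finset.univ.erase q₀, c q * g (x - v q)‖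
      ≤ ∑ _ ∈ Finset.univ.erase q₀, κ * η := norm_sum_le_of_le _ fun q hq => by
        rw [norm_mul]
        refine mul_le_mul (hc q) (hg _ ?_) (norm_nonneg _) hκ
        have hsep := (hv (Finset.ne_of_mem_erase hq).symm).trans
          (norm_sub_le_norm_sub_add_norm_sub (v q₀) x (v q))
        rw [norm_sub_rev (v q₀)] at hsep
        linarith
    _ ≤ ∑ _ : ι, κ * η := Finset.sum_le_sum_of_subset_of_nonneg (Finset.erase_subset _ _)
        fun _ _ _ => mul_nonneg hκ hη
    _ = κ * (Fintype.card ι * η) := by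
        rw [Finset.sum_const, Finset.card_univ, nsmul_eq_mul]; ring

theorem norm_sum_translates_le (hv : Pairwise fun q q' => ℓ ≤ ‖v q - v q'‖) {c : ι → ℂ}
    {κ η M : ℝ} (hκ : 0 ≤ κ) (hc : ∀ q, ‖c q‖ ≤ κ) {g : V → ℂ} (hη : 0 ≤ η)
    (hg : ∀ u, ℓ / 2 ≤ ‖u‖ → ‖g u‖ ≤ η) (hM : ∀ u, ‖g u‖ ≤ M) (x : V) :
    ‖∑ q, c q * g (x - v q)‖ ≤ κ * (M + Fintype.card ι * η) := by
  have hM₀ : 0 ≤ M := (norm_nonneg _).trans (hM 0)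
  by_cases hnear : ∃ q₀, ‖x - v q₀‖ ≤ ℓ / 2
  · obtain ⟨q₀, hq₀⟩ := hnear
    have hmain : ‖c q₀ * g (x - v q₀)‖ ≤ κ * M := by
      rw [norm_mul]
      exact mul_le_mul (hc _) (hM _) (norm_nonneg _) hκ
    linarith [norm_sum_translates_sub_le hv hc hη hg hq₀,
      norm_le_norm_sub_add (∑ q, c q * g (x - v q)) (c q₀ * g (x - v q₀))]
  · push Not at hnear
    calc ‖∑ q, c q * g (x - v q)‖ ≤ ∑ _ : ι, κ * η := norm_sum_le_of_le _ fun q _ => by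
          rw [norm_mul]
          exact mul_le_mul (hc q) (hg _ (hnear q).le) (norm_nonneg _) hκ
      _ = κ * (Fintype.card ι * η) := by
          rw [Finset.sum_const, Finset.card_univ, nsmul_eq_mul]; ring
      _ ≤ κ * (M + Fintype.card ι * η) := by gcongr; exact le_add_of_nonneg_left hM₀

end Separated

theorem exists_apply_add_smul_ne {E : Type*} [NormedAddCommGroup E] [NormedSpace ℝ E]
    [ProperSpace E] {ψ : 𝓢(E, ℂ)} (hψ : ψ ≠ 0) {e : E} (he : e ≠ 0) :
    ∃ (u : E) (δ : ℝ), 0 < δ ∧ ψ (u + δ • e) ≠ ψ u := by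
  by_contra! hconst
  refine hψ (DFunLike.ext _ _ fun u => ?_)
  have hfar : Filter.Tendsto (fun δ : ℝ => u + δ • e) Filter.atTop (Filter.cocompact E) := by
    rw [← Metric.cobounded_eq_cocompact, ← tendsto_norm_atTop_iff_cobounded]
    have hlinear : Filter.Tendsto (fun δ : ℝ => δ * ‖e‖ - ‖u‖) Filter.atTop Filter.atTop :=
      Filter.tendsto_atTop_add_const_right _ _
        (Filter.tendsto_id.atTop_mul_const (norm_pos_iff.2 he))
    refine Filter.tendsto_atTop_mono (fun δ => ?_) hlinear
    have htriangle := norm_sub_le (u + δ • e) u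
    rw [add_sub_cancel_left, norm_smul, Real.norm_eq_abs] at htriangle
    linarith [mul_le_mul_of_nonneg_right (le_abs_self δ) (norm_nonneg e)]
  refine tendsto_nhds_unique (tendsto_const_nhds.congr' ?_) (ψ.tendsto_cocompact.comp hfar)
  filter_upwards [Filter.eventually_gt_atTop 0] with δ hδ using (hconst u δ hδ).symm

theorem exists_forall_schwartz_norm_le {E : Type*} [NormedAddCommGroup E] [NormedSpace ℝ E]
    {S : Set 𝓢(E, ℂ)} (hS : S.Finite) : ∃ M : ℝ, 0 ≤ M ∧ ∀ g ∈ S, ∀ u, ‖g u‖ ≤ M := by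
  obtain ⟨M, hM⟩ := (hS.image (SchwartzMap.seminorm ℂ 0 0)).bddAbove
  exact ⟨max M 0, le_max_right _ _, fun g hg u => (SchwartzMap.norm_le_seminorm ℂ g u).trans
    ((hM (Set.mem_image_of_mem _ hg)).trans (le_max_left _ _))⟩

theorem exists_forall_schwartz_norm_le_of_le_norm {E : Type*} [NormedAddCommGroup E]
    [NormedSpace ℝ E] [ProperSpace E] {S : Set 𝓢(E, ℂ)} (hS : S.Finite) {η : ℝ} (hη : 0 < η) :
    ∃ R : ℝ, ∀ g ∈ S, ∀ u, R ≤ ‖u‖ → ‖g u‖ ≤ η := by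
  have hdecay (g : 𝓢(E, ℂ)) : ∀ᶠ u in Bornology.cobounded E, ‖g u‖ ≤ η := by
    rw [Metric.cobounded_eq_cocompact]
    exact g.tendsto_cocompact.norm.eventually_le_const (by simpa using hη)
  obtain ⟨R, -, hR⟩ := Filter.hasBasis_cobounded_norm.eventually_iff.1
    ((Filter.eventually_all_finite hS).2 fun g _ => hdecay g)
  exact ⟨R, fun g hg u hu => hR hu g hg⟩

theorem besovNorm_translateSum_dyadicKernel_zero_le {ι : Type*} [Fintype ι] {d : ℕ} {w : ℝ → ℝ}
    (hw : IsDyadicWindow w) {v : ι → Rn d} {c : ι → ℂ} {ℓ κ η M : ℝ}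
    (hv : Pairwise fun q q' => ℓ ≤ ‖v q - v q'‖) (hκ : 0 ≤ κ) (hc : ∀ q, ‖c q‖ ≤ κ) (hη : 0 ≤ η)
    (hdecay : ∀ n ∈ ({-1, 0, 1} : Finset ℤ), ∀ u, ℓ / 2 ≤ ‖u‖ →
      ‖schwartzPiece hw (dyadicKernel d hw 0) n u‖ ≤ η)
    (hM : ∀ n ∈ ({-1, 0, 1} : Finset ℤ), ∀ u,
      ‖schwartzPiece hw (dyadicKernel d hw 0) n u‖ ≤ M) :
    besovNorm hw (translateSum c v (dyadicKernel d hw 0) : 𝓢'(Rn d, ℂ)) ≤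
      ENNReal.ofReal (7 / 2 * (κ * (M + Fintype.card ι * η))) := by
  refine besovNorm_schwartz_le hw (fun n hn => schwartzPiece_translateSum_eq_zero _ v hw hn)
    fun n hn x => ?_
  rw [schwartzPiece_translateSum, translateSum_apply]
  exact norm_sum_translates_le hv hκ hc hη (hdecay n hn) (hM n hn) x

theorem exists_besov_interpolation {d : ℕ} {w : ℝ → ℝ} (hw : IsDyadicWindow w) :
    ∃ κ : ℝ, 0 < κ ∧ ∀ (ι : Type*) [Fintype ι] (r ε : ℝ), 0 < ε → ∃ ℓ : ℝ, ∀ v : ι → Rn d,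
      (Pairwise fun q q' => ℓ ≤ ‖v q - v q'‖) → ∀ θ : ι → ℂ, (∀ q, ‖θ q‖ ≤ 1) →
        besovNorm hw (translateSum (fun q => κ * θ q) v (dyadicKernel d hw 0) : 𝓢'(Rn d, ℂ)) ≤ 1 ∧
        ∀ q u, ‖u‖ ≤ r → ‖translateSum (fun q => κ * θ q) v (dyadicKernel d hw 0) (v q + u) -
          κ * θ q * dyadicKernel d hw 0 u‖ ≤ ε := by
  set ψ := dyadicKernel d hw 0
  have hfin : (insert ψ (schwartzPiece hw ψ '' {-1, 0, 1})).Finite :=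
    ((Set.toFinite _).image _).insert ψ
  have hmem {n : ℤ} (hn : n ∈ ({-1, 0, 1} : Finset ℤ)) :
      schwartzPiece hw ψ n ∈ insert ψ (schwartzPiece hw ψ '' {-1, 0, 1}) :=
    Set.mem_insert_of_mem _ (Set.mem_image_of_mem _ (by simpa using hn))
  obtain ⟨M, hM₀, hM⟩ := exists_forall_schwartz_norm_le hfin
  set κ : ℝ := 2 / (7 * (M + 1)) with hκ
  have hκ₀ : 0 < κ := by positivity
  refine ⟨κ, hκ₀, fun ι _ r ε hε => ?_⟩
  set η : ℝ := min 1 (ε / κ) / (Fintype.card ι + 1)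
  have hmin : 0 < min 1 (ε / κ) := lt_min one_pos (by positivity)
  have hη : 0 < η := by positivity
  have hcard : Fintype.card ι * η ≤ min 1 (ε / κ) := by
    rw [← mul_div_assoc, div_le_iff₀ (by positivity)]
    nlinarith
  obtain ⟨R, hdecay⟩ := exists_forall_schwartz_norm_le_of_le_norm hfin hη
  have hR {u : Rn d} (hu : 2 * max R r / 2 ≤ ‖u‖) : R ≤ ‖u‖ :=
    (le_max_left R r).trans (by linarith)
  refine ⟨2 * max R r, fun v hv θ hθ => ?_⟩
  have hc (q : ι) : ‖(κ : ℂ) * θ q‖ ≤ κ := by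
    rw [norm_mul, Complex.norm_real, Real.norm_of_nonneg hκ₀.le]
    exact mul_le_of_le_one_right hκ₀.le (hθ q)
  refine ⟨?_, fun q u hu => ?_⟩
  · refine (besovNorm_translateSum_dyadicKernel_zero_le hw hv hκ₀.le hc hη.le
      (fun n hn u hu => hdecay _ (hmem hn) u (hR hu)) fun n hn => hM _ (hmem hn)).trans ?_
    rw [ENNReal.ofReal_le_one]
    calc _ ≤ 7 / 2 * (κ * (M + 1)) := by gcongr; exact hcard.trans (min_le_left _ _)
      _ = 1 := by rw [hκ]; field_simp
  · have hnear := norm_sum_translates_sub_le (x := v q + u) (q₀ := q) hv hc hη.le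
      (fun u hu => hdecay ψ (Set.mem_insert _ _) u (hR hu)) (by
        rw [add_sub_cancel_left]
        exact hu.trans ((le_max_right R r).trans (by linarith)))
    rw [add_sub_cancel_left] at hnear
    rw [translateSum_apply]
    calc _ ≤ κ * (Fintype.card ι * η) := hnear
      _ ≤ κ * (ε / κ) := by gcongr; exact hcard.trans (min_le_right _ _)
      _ = ε := mul_div_cancel₀ _ hκ₀.ne'

theorem pairwise_le_norm_lattice_sub {N : ℕ} {ℓ : ℝ} (hℓ : 0 ≤ ℓ) :
    Pairwise fun q q' : Fin N × Fin N => ℓ ≤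
      ‖(!₂[(q.1 : ℝ) * ℓ, (q.2 : ℝ) * ℓ] : Rn 2) - !₂[(q'.1 : ℝ) * ℓ, (q'.2 : ℝ) * ℓ]‖ := by
  intro q q' hne
  have hgap (m n : Fin N) (hmn : m ≠ n) : ℓ ≤ |(m : ℝ) * ℓ - n * ℓ| := by
    rw [← sub_mul, abs_mul, abs_of_nonneg hℓ]
    refine le_mul_of_one_le_left hℓ ?_
    have hint : (m : ℤ) - n ≠ 0 := fun h => hmn (Fin.ext (by omega))
    exact_mod_cast Int.one_le_abs hint
  set u := (!₂[(q.1 : ℝ) * ℓ, (q.2 : ℝ) * ℓ] : Rn 2) - !₂[(q'.1 : ℝ) * ℓ, (q'.2 : ℝ) * ℓ]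
  by_cases hfst : q.1 = q'.1
  · have hsnd : q.2 ≠ q'.2 := fun h => hne (Prod.ext hfst h)
    exact (hgap _ _ hsnd).trans (by simpa [u] using PiLp.norm_apply_le u 1)
  · exact (hgap _ _ hfst).trans (by simpa [u] using PiLp.norm_apply_le u 0)

theorem exists_besov_increments {w : ℝ → ℝ} (hw : IsDyadicWindow w) :
    ∃ (δ : ℝ) (z : ℂ), 0 < δ ∧ z ≠ 0 ∧ ∀ N : ℕ, ∃ a b : Fin N → ℝ, ∀ θ : Fin N → Fin N → ℂ,
      (∀ i k, ‖θ i k‖ ≤ 1) → ∃ (F : 𝓢'(Rn 2, ℂ)) (f : Rn 2 → ℂ),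
        MemBesov hw F ∧ IsContinuousFunction F f ∧ besovNorm hw F ≤ 1 ∧
        ∀ i k, ‖f !₂[a i + δ, b k] - f !₂[a i, b k] - θ i k * z‖ ≤ ‖z‖ / 2 := by
  set ψ := dyadicKernel 2 hw 0
  set e : Rn 2 := EuclideanSpace.single 0 1 with he
  obtain ⟨u, δ, hδ, hne⟩ := exists_apply_add_smul_ne (dyadicKernel_zero_ne_zero (d := 1) hw)
    (e := e) (by simp [he])
  obtain ⟨κ, hκ, hinterp⟩ := exists_besov_interpolation (d := 2) hw
  set z := κ * (ψ (u + δ • e) - ψ u)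
  have hz : z ≠ 0 := mul_ne_zero (by exact_mod_cast hκ.ne') (sub_ne_zero.2 hne)
  refine ⟨δ, z, hδ, hz, fun N => ?_⟩
  obtain ⟨ℓ, hℓ⟩ := hinterp (Fin N × Fin N) (max ‖u + δ • e‖ ‖u‖) (‖z‖ / 4) (by positivity)
  set v : Fin N × Fin N → Rn 2 := fun q => !₂[(q.1 : ℝ) * |ℓ|, (q.2 : ℝ) * |ℓ|] with hv
  refine ⟨fun i => i * |ℓ| + u 0, fun k => k * |ℓ| + u 1, fun θ hθ => ?_⟩
  obtain ⟨hnorm, happrox⟩ := hℓ v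
    ((pairwise_le_norm_lattice_sub (abs_nonneg ℓ)).mono fun _ _ => (le_abs_self ℓ).trans)
    (fun q => θ q.1 q.2) (fun q => hθ q.1 q.2)
  refine ⟨_, _, memBesov_translateSum _ v hw, isContinuousFunction_schwartz _, hnorm,
    fun i k => ?_⟩
  have hshifted : (!₂[(i : ℝ) * |ℓ| + u 0 + δ, (k : ℝ) * |ℓ| + u 1] : Rn 2) =
      v (i, k) + (u + δ • e) := by
    ext j; fin_cases j <;> simp [hv, he, add_assoc]
  have hbase : (!₂[(i : ℝ) * |ℓ| + u 0, (k : ℝ) * |ℓ| + u 1] : Rn 2) = v (i, k) + u := by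
    ext j; fin_cases j <;> simp [hv]
  rw [hshifted, hbase]
  calc _ = _ := by congr 1; simp only [z]; ring
    _ ≤ ‖z‖ / 4 + ‖z‖ / 4 := norm_sub_le_of_le (happrox (i, k) _ (le_max_left _ _))
        (happrox (i, k) _ (le_max_right _ _))
    _ = ‖z‖ / 2 := by ring

end Interpolation

/-! ### Sharpness -/

section Sharpness

variable {ι E : Type*} [Fintype ι] [NormedAddCommGroup E] [InnerProductSpace ℂ E]

/-- The operator `∑ i, a i ⟨v i, ·⟩ v i`; for an orthonormal family `v` it has the eigenvectors
`v i` and the eigenvalues `a i`. -/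
def diagonalOperator (v : ι → E) (a : ι → ℝ) : E →L[ℂ] E :=
  ∑ i, (a i : ℂ) • (innerSL ℂ (v i)).smulRight (v i)

theorem diagonalOperator_apply (v : ι → E) (a : ι → ℝ) (x : E) :
    diagonalOperator v a x = ∑ i, (a i : ℂ) • inner ℂ (v i) x • v i := by
  simp [diagonalOperator, sum_apply]

theorem isSelfAdjoint_diagonalOperator [CompleteSpace E] (v : ι → E) (a : ι → ℝ) :
    IsSelfAdjoint (diagonalOperator v a) := by
  rw [ContinuousLinearMap.isSelfAdjoint_iff_isSymmetric]
  intro x y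
  simp only [ContinuousLinearMap.coe_coe, diagonalOperator_apply, sum_inner, inner_sum,
    inner_smul_left, inner_smul_right, Complex.conj_ofReal, inner_conj_symm]
  exact Finset.sum_congr rfl fun i _ => by ring

theorem isSelfAdjoint_add_ofReal_smul_one [CompleteSpace E] {A : E →L[ℂ] E}
    (hA : IsSelfAdjoint A) (δ : ℝ) : IsSelfAdjoint (A + (δ : ℂ) • 1) := by
  refine hA.add (IsSelfAdjoint.smul (Complex.conj_ofReal δ) ?_)
  exact .one _

theorem diagonalOperator_apply_self {v : ι → E} (hv : Orthonormal ℂ v) (a : ι → ℝ) (i : ι) :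
    diagonalOperator v a (v i) = (a i : ℂ) • v i := by
  classical
  simp [diagonalOperator_apply, orthonormal_iff_ite.1 hv]

theorem norm_sum_of_orthonormal {v : ι → E} (hv : Orthonormal ℂ v) :
    ‖∑ i, v i‖ = √(Fintype.card ι) := by
  rw [eq_comm, Real.sqrt_eq_iff_eq_sq (by positivity) (norm_nonneg _)]
  simpa [hv.1] using (norm_sum_smul_sq_of_pairwise_inner_eq_zero Finset.univ hv.2 1).symm

theorem card_mul_le_opNorm {e h : ι → E} (he : Orthonormal ℂ e) (hh : Orthonormal ℂ h)
    {R : E →L[ℂ] E} {ζ : ℂ} {ε : ℝ} (hR : ∀ i k, ‖inner ℂ (e i) (R (h k)) - ζ‖ ≤ ε) :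
    Fintype.card ι * (‖ζ‖ - ε) ≤ ‖R‖ := by
  rcases isEmpty_or_nonempty ι with _ | _
  · simp
  set n : ℝ := (Fintype.card ι : ℝ) with hn
  have hn₀ : 0 < n := by positivity
  set T := inner ℂ (∑ i, e i) (R (∑ k, h k)) with hT
  have hT_le : ‖T‖ ≤ n * ‖R‖ := by
    calc ‖T‖ ≤ ‖∑ i, e i‖ * (‖R‖ * ‖∑ k, h k‖) :=
          (norm_inner_le_norm _ _).trans (by gcongr; exact R.le_opNorm _)
      _ = √n * √n * ‖R‖ := by
          rw [norm_sum_of_orthonormal he, norm_sum_of_orthonormal hh]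
          ring
      _ = n * ‖R‖ := by rw [Real.mul_self_sqrt hn₀.le]
  have hT_sub : ‖T - n * (n * ζ)‖ ≤ n * (n * ε) := by
    calc ‖T - n * (n * ζ)‖ = ‖∑ k, ∑ i, (inner ℂ (e i) (R (h k)) - ζ)‖ := by
          rw [hT, map_sum, inner_sum]
          simp [hn, sum_inner]
      _ ≤ ∑ _k : ι, ∑ _i : ι, ε :=
          norm_sum_le_of_le _ fun k _ => norm_sum_le_of_le _ fun i _ => hR i k
      _ = n * (n * ε) := by simp [hn]
  have hζ : n * (n * ‖ζ‖) ≤ n * (n * ε) + n * ‖R‖ := by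
    calc n * (n * ‖ζ‖) = ‖(n * (n * ζ) : ℂ)‖ := by simp [abs_of_pos hn₀]
      _ ≤ ‖T - n * (n * ζ)‖ + ‖T‖ := by
          rw [norm_sub_rev]
          exact norm_le_norm_sub_add _ _
      _ ≤ _ := add_le_add hT_sub hT_le
  exact le_of_mul_le_mul_left (by linarith) hn₀

/-- The symbol `g i k ≈ √n * conj ⟨e i, h k⟩ * z` cancels the phases of the matrix `⟨e i, h k⟩`,
whose entries all have modulus `1 / √n`; what remains is close to the rank one matrix with all
entries `z / √n`, of norm `√n * ‖z‖`. -/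
theorem sqrt_card_mul_le_opNorm {e h : ι → E} (he : Orthonormal ℂ e) (hh : Orthonormal ℂ h)
    (heh : ∀ i k, ‖inner ℂ (e i) (h k)‖ = (√(Fintype.card ι))⁻¹) {g : ι → ι → ℂ} {z : ℂ}
    (hg : ∀ i k,
      ‖g i k - √(Fintype.card ι) * (starRingEnd ℂ) (inner ℂ (e i) (h k)) * z‖ ≤ ‖z‖ / 2)
    {R : E →L[ℂ] E} (hR : ∀ i k, inner ℂ (e i) (R (h k)) = g i k * inner ℂ (e i) (h k)) :
    √(Fintype.card ι) * (‖z‖ / 2) ≤ ‖R‖ := by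
  rcases isEmpty_or_nonempty ι with _ | _
  · simp
  set s := √(Fintype.card ι : ℝ)
  have hs₀ : 0 < s := by positivity
  have hss : s * s = Fintype.card ι := Real.mul_self_sqrt (by positivity)
  have hentry (i k : ι) : ‖inner ℂ (e i) (R (h k)) - (s : ℂ)⁻¹ * z‖ ≤ s⁻¹ * (‖z‖ / 2) := by
    have hphase : (s : ℂ) * (starRingEnd ℂ) (inner ℂ (e i) (h k)) * inner ℂ (e i) (h k) =
        (s : ℂ)⁻¹ := by
      rw [mul_assoc, Complex.conj_mul', heh]
      push_cast
      field_simp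
    rw [hR, ← hphase, ← heh i k, mul_comm ‖_‖]
    calc ‖g i k * inner ℂ (e i) (h k) -
          s * (starRingEnd ℂ) (inner ℂ (e i) (h k)) * inner ℂ (e i) (h k) * z‖
        = ‖g i k - s * (starRingEnd ℂ) (inner ℂ (e i) (h k)) * z‖ * ‖inner ℂ (e i) (h k)‖ := by
          rw [← norm_mul]
          ring_nf
      _ ≤ ‖z‖ / 2 * ‖inner ℂ (e i) (h k)‖ := by gcongr; exact hg i k
  calc s * (‖z‖ / 2) = Fintype.card ι * (‖(s : ℂ)⁻¹ * z‖ - s⁻¹ * (‖z‖ / 2)) := by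
        rw [← hss, norm_mul, norm_inv, Complex.norm_real, Real.norm_of_nonneg hs₀.le]
        field_simp
        ring
    _ ≤ ‖R‖ := card_mul_le_opNorm he hh hentry

/-- The `k`-th vector of the discrete Fourier basis of `ℂ ^ N`: a basis all of whose inner products
with the standard basis have the same modulus. -/
def dftVector (N : ℕ) (k : Fin N) : EuclideanSpace ℂ (Fin N) :=
  WithLp.toLp 2 fun j =>
    ((√N : ℝ) : ℂ)⁻¹ * (Complex.exp (2 * Real.pi * Complex.I / N) ^ (k : ℕ)) ^ (j : ℕ)

theorem sum_pow_div_pow_of_isPrimitiveRoot {ζ : ℂ} {N : ℕ} (hζ : IsPrimitiveRoot ζ N)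
    (k l : Fin N) :
    ∑ j : Fin N, (ζ ^ (l : ℕ) / ζ ^ (k : ℕ)) ^ (j : ℕ) = if k = l then (N : ℂ) else 0 := by
  have hζ₀ : ζ ≠ 0 := hζ.ne_zero k.pos.ne'
  rw [Fin.sum_univ_eq_sum_range fun j => (ζ ^ (l : ℕ) / ζ ^ (k : ℕ)) ^ j]
  split_ifs with hkl
  · simp [hkl, hζ₀]
  · have hne : ζ ^ (l : ℕ) / ζ ^ (k : ℕ) ≠ 1 := fun h =>
      hkl (Fin.ext (hζ.pow_inj l.2 k.2 ((div_eq_one_iff_eq (pow_ne_zero _ hζ₀)).1 h)).symm)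
    have hpow : (ζ ^ (l : ℕ) / ζ ^ (k : ℕ)) ^ N = 1 := by
      rw [div_pow, pow_right_comm, pow_right_comm ζ k, hζ.pow_eq_one, one_pow, one_pow, div_one]
    rw [geom_sum_eq hne, hpow, sub_self, zero_div]

theorem orthonormal_dftVector (N : ℕ) : Orthonormal ℂ (dftVector N) := by
  rw [orthonormal_iff_ite]
  intro k l
  have hN : N ≠ 0 := k.pos.ne'
  have hζ := Complex.isPrimitiveRoot_exp N hN
  set ζ := Complex.exp (2 * Real.pi * Complex.I / N) with hζ_def
  have hconj : (starRingEnd ℂ) ζ = ζ⁻¹ := (Complex.inv_eq_conj (hζ.norm'_eq_one hN)).symm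
  have hsqrt : (((√N : ℝ) : ℂ)⁻¹) * ((√N : ℝ) : ℂ)⁻¹ = (N : ℂ)⁻¹ := by
    rw [← mul_inv, ← Complex.ofReal_mul, Real.mul_self_sqrt N.cast_nonneg, Complex.ofReal_natCast]
  calc inner ℂ (dftVector N k) (dftVector N l)
      = ∑ j : Fin N, (N : ℂ)⁻¹ * (ζ ^ (l : ℕ) / ζ ^ (k : ℕ)) ^ (j : ℕ) := by
        rw [PiLp.inner_apply]
        refine Finset.sum_congr rfl fun j _ => ?_
        simp only [dftVector, RCLike.inner_apply, map_mul, map_pow, map_inv₀, Complex.conj_ofReal,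
          ← hζ_def, hconj]
        rw [← hsqrt, div_pow, div_eq_mul_inv, inv_pow, inv_pow]
        ring
    _ = if k = l then 1 else 0 := by
        rw [← Finset.mul_sum, sum_pow_div_pow_of_isPrimitiveRoot hζ, mul_ite, mul_zero,
          inv_mul_cancel₀ (Nat.cast_ne_zero.2 hN)]

theorem norm_inner_single_dftVector {N : ℕ} (i k : Fin N) :
    ‖inner ℂ (EuclideanSpace.single i (1 : ℂ)) (dftVector N k)‖ = (√N)⁻¹ := by
  have hN : N ≠ 0 := i.pos.ne'
  have hζ := (Complex.isPrimitiveRoot_exp N hN).norm'_eq_one hN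
  simp [EuclideanSpace.inner_single_left, dftVector, hζ]

theorem exists_besov_sqrt_mul_le_opNorm_pairFunction_sub {w : ℝ → ℝ} (hw : IsDyadicWindow w) :
    ∃ δ r : ℝ, 0 < δ ∧ 0 < r ∧ ∀ N : ℕ, ∃ (F : 𝓢'(Rn 2, ℂ)) (f : Rn 2 → ℂ)
      (A B : EuclideanSpace ℂ (Fin N) →L[ℂ] EuclideanSpace ℂ (Fin N)),
      MemBesov hw F ∧ IsContinuousFunction F f ∧ besovNorm hw F ≤ 1 ∧
      IsSelfAdjoint A ∧ IsSelfAdjoint B ∧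
      √N * r ≤ ‖pairFunction f (A + (δ : ℂ) • 1) B - pairFunction f A B‖ := by
  obtain ⟨δ, z, hδ, hz, hinc⟩ := exists_besov_increments hw
  refine ⟨δ, ‖z‖ / 2, hδ, half_pos (norm_pos_iff.2 hz), fun N => ?_⟩
  obtain ⟨a, b, hab⟩ := hinc N
  let e : Fin N → EuclideanSpace ℂ (Fin N) := fun i => EuclideanSpace.single i 1
  have he : Orthonormal ℂ e := EuclideanSpace.orthonormal_single
  have hh := orthonormal_dftVector N
  have heh (i k : Fin N) : ‖inner ℂ (e i) (dftVector N k)‖ = (√N)⁻¹ :=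
    norm_inner_single_dftVector i k
  obtain ⟨F, f, hF, hf, hF₁, hg⟩ := hab
    (fun i k => √N * (starRingEnd ℂ) (inner ℂ (e i) (dftVector N k))) fun i k => by
      rw [norm_mul, RCLike.norm_conj, heh, Complex.norm_real, Real.norm_of_nonneg (by positivity)]
      exact mul_inv_le_one
  set A := diagonalOperator e a
  set B := diagonalOperator (dftVector N) b
  have hA : IsSelfAdjoint A := isSelfAdjoint_diagonalOperator e a
  have hB : IsSelfAdjoint B := isSelfAdjoint_diagonalOperator _ b
  have hA' : IsSelfAdjoint (A + (δ : ℂ) • 1) := isSelfAdjoint_add_ofReal_smul_one hA δ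
  have hAe (i : Fin N) : A (e i) = (a i : ℂ) • e i := diagonalOperator_apply_self he a i
  have hA'e (i : Fin N) : (A + (δ : ℂ) • 1) (e i) = ((a i + δ : ℝ) : ℂ) • e i := by
    simp [hAe, add_smul]
  have hBh (k : Fin N) : B (dftVector N k) = (b k : ℂ) • dftVector N k :=
    diagonalOperator_apply_self hh b k
  have isSelfAdjointIn {T : EuclideanSpace ℂ (Fin N) →L[ℂ] EuclideanSpace ℂ (Fin N)}
      (hT : IsSelfAdjoint T) : IsSelfAdjointIn ⊤ T := ⟨hT, fun _ => Submodule.mem_top⟩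
  refine ⟨F, f, A, B, hF, hf, hF₁, hA, hB, ?_⟩
  have hlow := sqrt_card_mul_le_opNorm he hh (by simpa using heh) (by simpa using hg)
    (R := pairFunction f (A + (δ : ℂ) • 1) B - pairFunction f A B) fun i k => by
      rw [sub_apply, inner_sub_right,
        (isSelfAdjointIn hA').inner_pairFunction (isSelfAdjointIn hB) f (hA'e i) (hBh k),
        (isSelfAdjointIn hA).inner_pairFunction (isSelfAdjointIn hB) f (hAe i) (hBh k), ← sub_mul]
  rwa [Fintype.card_fin] at hlow

theorem rankLE_finrank [FiniteDimensional ℂ E] (T : E →L[ℂ] E) :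
    RankLE T (Module.finrank ℂ E) := by
  refine (LinearMap.rank_le_range _).trans ?_
  rw [Module.finrank_eq_rank]

theorem enorm_le_schattenNorm {p : ℝ≥0∞} (hp : p ≠ 0) (T : E →L[ℂ] E) :
    ‖T‖ₑ ≤ schattenNorm p T :=
  (schattenNorm_top T).symm.trans_le (schattenNorm_anti hp le_top T)

theorem finrank_rpow_mul_schattenNorm_smul_one_le [FiniteDimensional ℂ E] [Nontrivial E]
    {p : ℝ≥0∞} (hp : p ≠ 0) (c : ℂ) :
    (Module.finrank ℂ E : ℝ≥0∞) ^ ((1 : ℝ) / 2 - 1 / p.toReal) *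
      schattenNorm p (c • (1 : E →L[ℂ] E)) ≤ ENNReal.ofReal √(Module.finrank ℂ E) * ‖c‖ₑ := by
  set n := Module.finrank ℂ E
  have hn : 0 < n := Module.finrank_pos
  have hc : schattenNorm p (c • (1 : E →L[ℂ] E)) ≤ (n : ℝ≥0∞) ^ (1 / p.toReal) * ‖c‖ₑ := by
    calc schattenNorm p (c • (1 : E →L[ℂ] E))
        ≤ (n : ℝ≥0∞) ^ (1 / p.toReal) * ‖c • (1 : E →L[ℂ] E)‖ₑ := by
          simpa [schattenNorm_top] using
            schattenNorm_le_rank_rpow_mul hp le_top (rankLE_finrank (c • (1 : E →L[ℂ] E)))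
      _ ≤ (n : ℝ≥0∞) ^ (1 / p.toReal) * ‖c‖ₑ := by
          gcongr
          refine enorm_le_iff_norm_le.2 ((ContinuousLinearMap.opNorm_smul_le _ _).trans ?_)
          exact mul_le_of_le_one_right (norm_nonneg c) ContinuousLinearMap.norm_id_le
  calc (n : ℝ≥0∞) ^ ((1 : ℝ) / 2 - 1 / p.toReal) * schattenNorm p (c • (1 : E →L[ℂ] E))
      ≤ (n : ℝ≥0∞) ^ ((1 : ℝ) / 2 - 1 / p.toReal) * ((n : ℝ≥0∞) ^ (1 / p.toReal) * ‖c‖ₑ) := by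
        gcongr
    _ = ENNReal.ofReal √n * ‖c‖ₑ := by
        rw [← mul_assoc, ← ENNReal.rpow_add _ _ (by exact_mod_cast hn.ne') (by simp),
          sub_add_cancel, Real.sqrt_eq_rpow, ← ENNReal.ofReal_rpow_of_pos (by exact_mod_cast hn),
          ENNReal.ofReal_natCast]

theorem exists_le_schattenNorm_pairFunction_sub {w : ℝ → ℝ} (hw : IsDyadicWindow w) :
    ∃ c : ℝ≥0, 0 < c ∧ ∀ (p : ℝ≥0∞) (_ : p ≠ 0) (N : ℕ) (_ : 1 ≤ N),
      ∃ (F : 𝓢'(Rn 2, ℂ)) (f : Rn 2 → ℂ)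
        (A₁ A₂ B : EuclideanSpace ℂ (Fin N) →L[ℂ] EuclideanSpace ℂ (Fin N)),
        MemBesov hw F ∧ IsContinuousFunction F f ∧ besovNorm hw F ≤ 1 ∧
        IsSelfAdjoint A₁ ∧ IsSelfAdjoint A₂ ∧ IsSelfAdjoint B ∧
        RankLE A₁ N ∧ RankLE A₂ N ∧ RankLE B N ∧ A₁ ≠ A₂ ∧
        c * (N : ℝ≥0∞) ^ ((1 : ℝ) / 2 - 1 / p.toReal) * schattenNorm p (A₁ - A₂) ≤
          schattenNorm p (pairFunction f A₁ B - pairFunction f A₂ B) := by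
  obtain ⟨δ, r, hδ, hr, hexists⟩ := exists_besov_sqrt_mul_le_opNorm_pairFunction_sub hw
  have hc : 0 < r / δ := by positivity
  refine ⟨(r / δ).toNNReal, Real.toNNReal_pos.2 hc, fun p hp N hN => ?_⟩
  obtain ⟨F, f, A, B, hF, hf, hF₁, hA, hB, hlow⟩ := hexists N
  have : NeZero N := ⟨Nat.one_le_iff_ne_zero.1 hN⟩
  have hrank (T : EuclideanSpace ℂ (Fin N) →L[ℂ] EuclideanSpace ℂ (Fin N)) : RankLE T N := by
    simpa using rankLE_finrank T
  have hA' : IsSelfAdjoint (A + (δ : ℂ) • 1) := isSelfAdjoint_add_ofReal_smul_one hA δ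
  refine ⟨F, f, A + (δ : ℂ) • 1, A, B, hF, hf, hF₁, hA', hA, hB, hrank _, hrank _, hrank _,
    fun h => smul_ne_zero (Complex.ofReal_ne_zero.2 hδ.ne') one_ne_zero (add_eq_left.1 h), ?_⟩
  have hshift := finrank_rpow_mul_schattenNorm_smul_one_le (E := EuclideanSpace ℂ (Fin N)) hp δ
  rw [finrank_euclideanSpace_fin, ← ofReal_norm, Complex.norm_real,
    Real.norm_of_nonneg hδ.le] at hshift
  calc (r / δ).toNNReal * (N : ℝ≥0∞) ^ ((1 : ℝ) / 2 - 1 / p.toReal) *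
        schattenNorm p (A + (δ : ℂ) • 1 - A)
      ≤ ENNReal.ofReal (r / δ) * (ENNReal.ofReal √N * ENNReal.ofReal δ) := by
        rw [add_sub_cancel_left, mul_assoc]
        exact mul_le_mul_right hshift _
    _ = ENNReal.ofReal (√N * r) := by
        rw [← ENNReal.ofReal_mul (by positivity), ← ENNReal.ofReal_mul hc.le]
        congr 1
        field_simp
    _ ≤ ‖pairFunction f (A + (δ : ℂ) • 1) B - pairFunction f A B‖ₑ := by
        rw [← ofReal_norm]
        exact ENNReal.ofReal_le_ofReal hlow
    _ ≤ _ := enorm_le_schattenNorm hp _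

end Sharpness

end

theorem theorem5p1 (w : ℝ → ℝ) (hw : IsDyadicWindow w) :
    (∃ C : ℝ≥0, ∀ (p : ℝ≥0∞) (_ : 2 ≤ p) (N : ℕ)
      (H : Type*) [NormedAddCommGroup H] [InnerProductSpace ℂ H] [CompleteSpace H]
      (A₁ B₁ A₂ B₂ : H →L[ℂ] H)
      (_ : IsSelfAdjoint A₁) (_ : IsSelfAdjoint B₁) (_ : IsSelfAdjoint A₂) (_ : IsSelfAdjoint B₂)
      (_ : RankLE A₁ N) (_ : RankLE B₁ N) (_ : RankLE A₂ N) (_ : RankLE B₂ N)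
      (F : 𝓢'(Rn 2, ℂ)) (f : Rn 2 → ℂ) (_ : MemBesov hw F) (_ : IsContinuousFunction F f),
      schattenNorm p (pairFunction f A₁ B₁ - pairFunction f A₂ B₂) ≤
        C * (N : ℝ≥0∞) ^ ((1 : ℝ) / 2 - 1 / p.toReal) * besovNorm hw F *
          max (schattenNorm p (A₁ - A₂)) (schattenNorm p (B₁ - B₂))) ∧
    (∃ c : ℝ≥0, 0 < c ∧ ∀ (p : ℝ≥0∞) (_ : 2 ≤ p) (N : ℕ) (_ : 1 ≤ N),
      ∃ (F : 𝓢'(Rn 2, ℂ)) (f : Rn 2 → ℂ)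
        (A₁ A₂ B : EuclideanSpace ℂ (Fin N) →L[ℂ] EuclideanSpace ℂ (Fin N)),
        MemBesov hw F ∧ IsContinuousFunction F f ∧ besovNorm hw F ≤ 1 ∧
        IsSelfAdjoint A₁ ∧ IsSelfAdjoint A₂ ∧ IsSelfAdjoint B ∧
        RankLE A₁ N ∧ RankLE A₂ N ∧ RankLE B N ∧ A₁ ≠ A₂ ∧
        c * (N : ℝ≥0∞) ^ ((1 : ℝ) / 2 - 1 / p.toReal) * schattenNorm p (A₁ - A₂) ≤
          schattenNorm p (pairFunction f A₁ B - pairFunction f A₂ B)) := by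
  obtain ⟨c, hc, hsharp⟩ := exists_le_schattenNorm_pairFunction_sub hw
  exact ⟨exists_schattenNorm_pairFunction_sub_le hw, c, hc,
    fun p hp => hsharp p (two_pos.trans_le hp).ne'⟩
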